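/- Let $\mathcal F$ be a germ of holomorphic foliation at $0\in\mathbb C^2$, induced by a holomorphic vector field $X=a\,\partial_x+b\,\partial_y$ with $\mathrm{Sing}(X)\subset\{0\}$, and let $\Gamma$ be a germ of reduced singular curve at $0$ (that is, of multiplicity at least $2$) which is invariant by $\mathcal F$. Definitions. For an irreducible invariant curve germ $\gamma$ with Puiseux parametrization $\alpha$, $Z_0(\mathcal F,\gamma)$ is the vanishing order at the origin of the vector field $\alpha^*X=h(t)\,\partial_t$, where $h(t)\,\alpha'(t)=X(\alpha(t))$. For an irreducible curve germ $g=0$ at $P$, $\mathrm{tang}_P(\mathcal F,\{g=0\})=\dim_{\mathbb C}\mathbb C\{x,y\}/(g,X(g))$ (in local coordinates centred at $P$, with $X$ inducing $\mathcal F$ at $P$ and having at most an isolated singularity). Let $\pi$ be the minimal desingularization of $\Gamma$: the minimal sequence of point blow-ups over $0$ after which the strict transforms of the branches of $\Gamma$ are smooth, pairwise disjoint and transverse to the exceptional divisor $E=\pi^{-1}(0)\neq\emptyset$ at points that lie on a single component of $E$. For a branch $\gamma$, let $P_\gamma$ be the point where its strict transform meets $E$, let $D_\gamma$ be the component of $E$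 through $P_\gamma$, and let $\pi^*\mathcal F$ be the strict transform of $\mathcal F$. Put $\kappa_{P_\gamma}=\mathrm{tang}_{P_\gamma}(\pi^*\mathcal F,D_\gamma)$ if $D_\gamma$ is not invariant by $\pi^*\mathcal F$, and $\kappa_{P_\gamma}=Z_{P_\gamma}(\pi^*\mathcal F,D_\gamma)$ if it is. The curve $\Gamma$ is weakly isolated for $\mathcal F$ if the set of its branches can be split into two disjoint sets such that the branches of the first set are at most two in number, smooth, and mutually transverse, and $\kappa_{P_\gamma}\ge 1$ for every branch $\gamma$ of the second set. Lemma. Assume that $\Gamma$ is weakly isolated for $\mathcal F$ and that its branches are smooth and pairwise transverse. Let $f=0$ be a reduced equation of $\Gamma$ and let $\mathcal H$ be the foliation $df=0$, induced by the vector field $f_y\,\partial_x-f_x\,\partial_y$. Then $$Z_0(\mathcal F,\gamma)\ \ge\ Z_0(\mathcal H,\gamma)\ \ge\ 1$$ for every irreducible component $\gamma$ of $\Gamma$. -/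

import Mathlib

open scoped PowerSeries

namespace PlaneFoliation

/-! ### The ring of convergent power series -/

/-- A power series with complex coefficients converges (absolutely) on some polydisc. -/
def IsConvergent {σ : Type*} (f : MvPowerSeries σ ℂ) : Prop :=
  ∃ r : ℝ, 0 < r ∧ Summable fun m : σ →₀ ℕ => ‖MvPowerSeries.coeff m f‖ * r ^ m.degree

theorem summable_of_le {σ : Type*} {f : MvPowerSeries σ ℂ} {r s : ℝ} (hs : 0 < s) (hsr : s ≤ r)
    (h : Summable fun m : σ →₀ ℕ => ‖MvPowerSeries.coeff m f‖ * r ^ m.degree) :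
    Summable fun m : σ →₀ ℕ => ‖MvPowerSeries.coeff m f‖ * s ^ m.degree := by
  refine Summable.of_nonneg_of_le (fun m => by positivity) (fun m => ?_) h
  gcongr

theorem isConvergent_add {σ : Type*} {f g : MvPowerSeries σ ℂ} (hf : IsConvergent f)
    (hg : IsConvergent g) : IsConvergent (f + g) := by
  obtain ⟨r, hr, hf⟩ := hf
  obtain ⟨s, hs, hg⟩ := hg
  have hm : 0 < min r s := lt_min hr hs
  refine ⟨min r s, hm, ?_⟩
  refine Summable.of_nonneg_of_le (fun m => by positivity) (fun m => ?_)
    ((summable_of_le hm (min_le_left r s) hf).add (summable_of_le hm (min_le_right r s) hg))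
  rw [← add_mul, map_add]
  gcongr
  exact norm_add_le _ _

theorem isConvergent_mul {σ : Type*} {f g : MvPowerSeries σ ℂ} (hf : IsConvergent f)
    (hg : IsConvergent g) : IsConvergent (f * g) := by
  classical
  obtain ⟨r, hr, hf⟩ := hf
  obtain ⟨s, hs, hg⟩ := hg
  have hm : 0 < min r s := lt_min hr hs
  refine ⟨min r s, hm, ?_⟩
  have h1 := summable_of_le hm (min_le_left r s) hf
  have h2 := summable_of_le hm (min_le_right r s) hg
  set t := min r s with ht
  let u : (σ →₀ ℕ) → ℝ := fun m => ‖MvPowerSeries.coeff m f‖ * t ^ m.degree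
  let v : (σ →₀ ℕ) → ℝ := fun m => ‖MvPowerSeries.coeff m g‖ * t ^ m.degree
  have hu : 0 ≤ u := fun m => mul_nonneg (norm_nonneg _) (pow_nonneg hm.le _)
  have hv : 0 ≤ v := fun m => mul_nonneg (norm_nonneg _) (pow_nonneg hm.le _)
  have h0 : Summable fun p : (σ →₀ ℕ) × (σ →₀ ℕ) => u p.1 * v p.2 :=
    Summable.mul_of_nonneg h1 h2 hu hv
  have h3 : Summable fun m => ∑ p ∈ Finset.HasAntidiagonal.antidiagonal m, u p.1 * v p.2 :=
    summable_sum_mul_antidiagonal_of_summable_mul h0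
  refine Summable.of_nonneg_of_le
    (fun m => mul_nonneg (norm_nonneg _) (pow_nonneg hm.le _)) (fun m => ?_) h3
  have h4 : ‖MvPowerSeries.coeff m (f * g)‖ ≤ ∑ p ∈ Finset.HasAntidiagonal.antidiagonal m,
      ‖MvPowerSeries.coeff p.1 f‖ * ‖MvPowerSeries.coeff p.2 g‖ := by
    rw [MvPowerSeries.coeff_mul]
    exact (norm_sum_le _ _).trans (le_of_eq (Finset.sum_congr rfl fun p _ => norm_mul _ _))
  refine (mul_le_mul_of_nonneg_right h4 (pow_nonneg hm.le _)).trans (le_of_eq ?_)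
  rw [Finset.sum_mul]
  refine Finset.sum_congr rfl fun p hp => ?_
  have h5 : m.degree = p.1.degree + p.2.degree := by
    rw [← Finset.HasAntidiagonal.mem_antidiagonal.1 hp, map_add]
  change _ = (_ * _) * (_ * _)
  rw [h5, pow_add]
  ring

theorem isConvergent_of_finite {σ : Type*} {f : MvPowerSeries σ ℂ}
    (h : {m | MvPowerSeries.coeff m f ≠ 0}.Finite) : IsConvergent f := by
  refine ⟨1, one_pos, summable_of_ne_finset_zero (s := h.toFinset) fun m hm => ?_⟩
  have : MvPowerSeries.coeff m f = 0 := by simpa using hm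
  simp [this]

theorem isConvergent_C {σ : Type*} (c : ℂ) :
    IsConvergent (MvPowerSeries.C c : MvPowerSeries σ ℂ) := by
  classical
  refine isConvergent_of_finite ((Set.finite_singleton 0).subset fun m hm => ?_)
  by_contra h
  exact hm (by rw [MvPowerSeries.coeff_C, if_neg (by simpa using h)])

theorem isConvergent_X {σ : Type*} (i : σ) :
    IsConvergent (MvPowerSeries.X i : MvPowerSeries σ ℂ) := by
  classical
  refine isConvergent_of_finite ((Set.finite_singleton (Finsupp.single i 1)).subset fun m hm => ?_)
  by_contra h
  exact hm (by rw [MvPowerSeries.coeff_X, if_neg (by simpa using h)])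

theorem isConvergent_pderiv {σ : Type*} {f : MvPowerSeries σ ℂ} (i : σ) (hf : IsConvergent f) :
    IsConvergent (MvPowerSeries.pderiv ℂ i f) := by
  obtain ⟨r, hr, hf⟩ := hf
  refine ⟨r / 2, by positivity, ?_⟩
  have h1 := (hf.comp_injective (add_left_injective (Finsupp.single i 1))).mul_left (1 / r)
  refine Summable.of_nonneg_of_le (fun m => by positivity) (fun m => ?_) h1
  have h2 : ((m i : ℝ) + 1) ≤ 2 ^ m.degree := by
    have h3 : m i + 1 ≤ 2 ^ m.degree :=
      (Nat.succ_le_of_lt Nat.lt_two_pow_self).trans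
        (Nat.pow_le_pow_right (by norm_num) (Finsupp.le_degree i m))
    exact_mod_cast h3
  have h4 : ‖((m i : ℂ) + 1)‖ = (m i : ℝ) + 1 := by
    rw [← Nat.cast_succ, Complex.norm_natCast, Nat.cast_succ]
  rw [MvPowerSeries.coeff_pderiv, norm_mul, h4, div_pow]
  simp only [Function.comp, map_add, Finsupp.degree_single, pow_succ]
  have h5 : ((m i : ℝ) + 1) / 2 ^ m.degree ≤ 1 := (div_le_one (by positivity)).2 h2
  calc _ = ‖MvPowerSeries.coeff (m + Finsupp.single i 1) f‖ * r ^ m.degree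
        * (((m i : ℝ) + 1) / 2 ^ m.degree) := by ring
    _ ≤ ‖MvPowerSeries.coeff (m + Finsupp.single i 1) f‖ * r ^ m.degree * 1 := by gcongr
    _ = _ := by field_simp

/-- The algebra `ℂ{x, y}` inside `ℂ[[x, y]]`. -/
noncomputable def convergentSeries : Subalgebra ℂ (MvPowerSeries (Fin 2) ℂ) where
  carrier := {f | IsConvergent f}
  mul_mem' := isConvergent_mul
  add_mem' := isConvergent_add
  algebraMap_mem' c := isConvergent_C c

/-- The local ring `ℂ{x, y}` of germs of holomorphic functions at the origin of `ℂ²`. -/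
abbrev O₂ : Type := convergentSeries

/-- The coordinate functions: `var 0 = x` and `var 1 = y`. -/
noncomputable def var (i : Fin 2) : O₂ := ⟨MvPowerSeries.X i, isConvergent_X i⟩

/-- The partial derivative with respect to the `i`-th coordinate. -/
noncomputable def pd (i : Fin 2) (f : O₂) : O₂ :=
  ⟨MvPowerSeries.pderiv ℂ i f.1, isConvergent_pderiv i f.2⟩

/-- The multiplicity `ν₀(f)` (with `ν₀(0) = ⊤`). -/
noncomputable def mult (f : O₂) : ℕ∞ := f.1.order

/-! ### Vector fields and parametrized arcs -/

/-- `X` stands for the germ of vector field `X 0 ∂/∂x + X 1 ∂/∂y`. -/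
abbrev VectorField : Type := Fin 2 → O₂

/-- The derivative `X(f)`. -/
noncomputable def VectorField.apply (X : VectorField) (f : O₂) : O₂ := ∑ j, X j * pd j f

/-- `Sing X ⊆ {0}`: the components of `X` have no common non-unit factor, i.e. the zero set of `X`
contains no curve.  A germ of holomorphic foliation is given by such a vector field. -/
def VectorField.SingularSetIsolated (X : VectorField) : Prop := IsRelPrime (X 0) (X 1)

/-- The curve `f = 0` is invariant by `X`. -/
def VectorField.LeavesInvariant (X : VectorField) (f : O₂) : Prop := f ∣ X.apply f

/-- The hamiltonian vector field `f_y ∂/∂x - f_x ∂/∂y`, tangent to the foliation `df = 0`; its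
singular set is isolated if `f` is reduced. -/
noncomputable def hamiltonian (f : O₂) : VectorField := ![pd 1 f, -pd 0 f]

/-- A holomorphic map germ `(ℂ, 0) → (ℂ², 0)`. -/
structure Arc where
  coord : Fin 2 → ℂ⟦X⟧
  convergent : ∀ i, IsConvergent (coord i)
  constantCoeff_eq_zero : ∀ i, PowerSeries.constantCoeff (coord i) = 0

/-- The composition `f ∘ α`. -/
noncomputable def Arc.pullback (α : Arc) (f : O₂) : ℂ⟦X⟧ := MvPowerSeries.subst α.coord f.1

/-- The vanishing order of `α` at the origin. -/
noncomputable def Arc.mult (α : Arc) : ℕ∞ := min (α.coord 0).order (α.coord 1).order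

/-- `α^* X = h(t) ∂/∂t`, i.e. `h(t) α'(t) = X(α(t))`. -/
def Arc.IsPullbackField (α : Arc) (X : VectorField) (h : ℂ⟦X⟧) : Prop :=
  ∀ i, h * PowerSeries.derivative ℂ (α.coord i) = α.pullback (X i)

open Classical in
/-- The vanishing order at the origin of `α^* X` (by convention `0` if `X` is not tangent
to `α`). When `α` is a Puiseux parametrization of an invariant curve `γ` of the foliation induced
by `X`, this is the index `Z₀(F, γ)`. -/
noncomputable def vanishingOrder (X : VectorField) (α : Arc) : ℕ∞ :=
  if H : ∃ h, α.IsPullbackField X h then H.choose.order else 0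

/-- The vanishing order does not depend on choices. -/
theorem vanishingOrder_eq {X : VectorField} {α : Arc} {h : ℂ⟦X⟧} (H : α.IsPullbackField X h)
    (hα : ∃ i, PowerSeries.derivative ℂ (α.coord i) ≠ 0) : vanishingOrder X α = h.order := by
  have H' : ∃ h, α.IsPullbackField X h := ⟨h, H⟩
  obtain ⟨i, hi⟩ := hα
  have e : H'.choose = h := mul_right_cancel₀ hi ((H'.choose_spec i).trans (H i).symm)
  rw [vanishingOrder, dif_pos H', e]

/-- The tangency order `dim_ℂ ℂ{x, y} / (f, X(f))` between `X` and the curve `f = 0`. -/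
noncomputable def tang (X : VectorField) (f : O₂) : ℕ∞ :=
  Cardinal.toENat (Module.rank ℂ (O₂ ⧸ Ideal.span {f, X.apply f}))

theorem isConvergent_powerSeries_X : IsConvergent (PowerSeries.X : ℂ⟦X⟧) := isConvergent_X ()

theorem isConvergent_powerSeries_zero : IsConvergent (0 : ℂ⟦X⟧) :=
  isConvergent_of_finite (by simp)

/-- The parametrization of the axis `var e = 0` by the other coordinate. -/
noncomputable def axis (e : Fin 2) : Arc where
  coord i := if i = e then 0 else PowerSeries.X
  convergent i := by
    split_ifs
    · exact isConvergent_powerSeries_zero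
    · exact isConvergent_powerSeries_X
  constantCoeff_eq_zero i := by split_ifs <;> simp

open Classical in
/-- The index `κ` at the origin of `X` with respect to the component `var e = 0` of the normal
crossings divisor `⋃_{i ∈ E} {var i = 0}`. -/
noncomputable def kappa (X : VectorField) (E : Set (Fin 2)) (e : Fin 2) : ℕ∞ :=
  if ¬ X.LeavesInvariant (var e) then tang X (var e)
  else if ∃ i ∈ E, i ≠ e ∧ X.LeavesInvariant (var i) then vanishingOrder X (axis e) - 1
  else vanishingOrder X (axis e)

/-! ### Curves -/

/-- An irreducible germ of curve `γ` at the origin, with an equation and a Puiseux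
parametrization. A map germ `arc` into `γ` is a reparametrization of a Puiseux
parametrization exactly when its vanishing order is the multiplicity of `γ` (the
vanishing order of any other nonconstant one is a multiple by an integer `> 1`). -/
structure Branch where
  eqn : O₂
  irreducible : Irreducible eqn
  arc : Arc
  pullback_eqn : arc.pullback eqn = 0
  arc_mult : arc.mult = mult eqn

/-- The branch is smooth: it has multiplicity `1`. -/
def Branch.IsSmooth (γ : Branch) : Prop := mult γ.eqn = 1

/-- The linear part of the equation is `γ.linear 0 * x + γ.linear 1 * y`. -/
noncomputable def Branch.linear (γ : Branch) (i : Fin 2) : ℂ :=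
  MvPowerSeries.coeff (Finsupp.single i 1) γ.eqn.1

/-- Transversality of smooth branches: the tangent lines are different. -/
def Branch.Transverse (γ η : Branch) : Prop :=
  γ.linear 0 * η.linear 1 - γ.linear 1 * η.linear 0 ≠ 0

/-- A reduced germ of curve at the origin, given as the union of finitely many different
branches. -/
structure CurveGerm where
  n : ℕ
  branch : Fin n → Branch
  distinct : Pairwise fun i j => ¬ Associated (branch i).eqn (branch j).eqn

/-- `f = 0` is a reduced equation of `Γ`. -/
def CurveGerm.IsReducedEquation (Γ : CurveGerm) (f : O₂) : Prop :=
  Associated f (∏ i, (Γ.branch i).eqn)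

/-- `Γ` is singular: its multiplicity is at least `2`. -/
def CurveGerm.IsSingular (Γ : CurveGerm) : Prop := 2 ≤ mult (∏ i, (Γ.branch i).eqn)

/-- `Γ` is invariant by `X`. -/
def CurveGerm.IsInvariant (Γ : CurveGerm) (X : VectorField) : Prop :=
  ∀ i, X.LeavesInvariant (Γ.branch i).eqn

/-! ### Blow-ups -/

/-- Local charts of the blow-up of the origin, centred at the points of the exceptional divisor. -/
inductive Chart where
  /-- `(x, y) ↦ (x, x (y + c))`, centred at the direction of slope `c`. -/
  | affine (c : ℂ)
  /-- `(x, y) ↦ (x y, y)`, centred at the vertical direction. -/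
  | vertical

/-- The components of the blow-up map in the chart. -/
noncomputable def Chart.map : Chart → Fin 2 → O₂
  | .affine c => ![var 0, var 0 * (var 1 + algebraMap ℂ O₂ c)]
  | .vertical => ![var 0 * var 1, var 1]

/-- The exceptional divisor of the blow-up is the axis `var exc = 0`. -/
def Chart.exc : Chart → Fin 2
  | .affine _ => 0
  | .vertical => 1

/-- Composition with the blow-up map. -/
noncomputable def Chart.pullback (ch : Chart) (f : O₂) : MvPowerSeries (Fin 2) ℂ :=
  MvPowerSeries.subst (fun i => (ch.map i).1) f.1

/-- `Y` induces the strict transform by the blow-up map `σ` of the foliation induced by `X`: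
the pullback `σ^* X = (Dσ)⁻¹ (X ∘ σ)` equals `z ^ (k - 1) Y`, where `z = 0` is the
exceptional divisor and `Y` is not divisible by `z`. -/
def Chart.FieldTransform (ch : Chart) (X Y : VectorField) : Prop :=
  (∃ k : ℕ, ∀ i, (var ch.exc).1 * ch.pullback (X i) =
    (var ch.exc ^ k * ∑ j, Y j * pd j (ch.map i) : O₂).1) ∧
  ¬ ∀ j, var ch.exc ∣ Y j

/-- The strict transform of the arc `α` passes through the centre of the chart, and
is `β`: one has `α = σ ∘ β`. -/
def Chart.ArcTransform (ch : Chart) (α β : Arc) : Prop :=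
  ∀ i, α.coord i = β.pullback (ch.map i)

/-- If near the centre of blow-up the divisor is the union of the axes `var i = 0` with `i ∈ E`,
these are the components of its total transform through the centre of the chart. -/
def Chart.totalTransform (ch : Chart) (E : Set (Fin 2)) : Set (Fin 2) :=
  match ch with
  | .affine c => {0} ∪ {i | i = 1 ∧ 1 ∈ E ∧ c = 0}
  | .vertical => {1} ∪ {i | i = 0 ∧ 0 ∈ E}

/-- A list of charts encodes a point infinitely near to the origin: one blows up the origin, then
the centre of the first chart, and so on; the point is the centre of the last chart.
`fieldTransform w X Y` says that `Y` induces at `w` the strict transform of the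
foliation induced by `X`. -/
def fieldTransform : List Chart → VectorField → VectorField → Prop
  | [], X, Y => Y = X
  | ch :: w, X, Y => ∃ X₁, ch.FieldTransform X X₁ ∧ fieldTransform w X₁ Y

/-- The strict transform of `α` passes through the infinitely near point `w`, and is `β`. -/
def arcTransform : List Chart → Arc → Arc → Prop
  | [], α, β => β = α
  | ch :: w, α, β => ∃ α₁, ch.ArcTransform α α₁ ∧ arcTransform w α₁ β

/-- The components of the exceptional divisor through the infinitely near point `w`. -/
def excDivisor (w : List Chart) : Set (Fin 2) := w.foldl (fun E ch => ch.totalTransform E) ∅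

/-- `w` is a point of the strict transform of the `i`-th branch `γ` of `Γ` that belongs to a
single component `var e = 0` of the exceptional divisor, `γ` is (smooth and) transverse to the
divisor there, and the strict transforms of the other branches do not contain `w`. -/
def CurveGerm.ResolvedAt (Γ : CurveGerm) (i : Fin Γ.n) (w : List Chart) : Prop :=
  (∃ e β, excDivisor w = {e} ∧ arcTransform w (Γ.branch i).arc β ∧ (β.coord e).order = 1) ∧
  ∀ j, j ≠ i → ¬ ∃ β, arcTransform w (Γ.branch j).arc β

/-- `w` is the point where the strict transform of the `i`-th branch meets the exceptional divisor
of the minimal desingularization of the singular curve `Γ`: the first resolved infinitely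
near point. -/
def CurveGerm.IsEndPoint (Γ : CurveGerm) (i : Fin Γ.n) (w : List Chart) : Prop :=
  Γ.ResolvedAt i w ∧ ∀ v, v <+: w → v ≠ w → ¬ Γ.ResolvedAt i v

/-- `κ_{P_γ}(π^* F, D_γ) ≥ 1`, where `F` is induced by `X`, `π` is the minimal desingularization
of `Γ`, `γ` is the `i`-th branch, `P_γ` is the point where the strict transform of `γ` meets the
exceptional divisor and `D_γ` is the component that contains `P_γ`. -/
def CurveGerm.KappaPositive (Γ : CurveGerm) (X : VectorField) (i : Fin Γ.n) : Prop :=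
  ∃ w e Y, Γ.IsEndPoint i w ∧ excDivisor w = {e} ∧ fieldTransform w X Y ∧
    1 ≤ kappa Y (excDivisor w) e

/-- The singular invariant curve `Γ` is weakly isolated for the foliation induced by `X`: the
branches outside some subset `N`, whose union is a normal crossings divisor, have positive `κ`.
(Different branches only meet at the origin.) -/
def CurveGerm.IsWeaklyIsolated (Γ : CurveGerm) (X : VectorField) : Prop :=
  Γ.IsSingular ∧ Γ.IsInvariant X ∧
  ∃ N : Finset (Fin Γ.n), N.card ≤ 2 ∧ (∀ i ∈ N, (Γ.branch i).IsSmooth) ∧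
    (∀ i ∈ N, ∀ j ∈ N, i ≠ j → (Γ.branch i).Transverse (Γ.branch j)) ∧
    ∀ i, i ∉ N → Γ.KappaPositive X i

end PlaneFoliation

/-!
Let `n ≥ 2` be the number of branches of `Γ`, and let `ν` be the multiplicity of the vector field
`F` at the origin.

If `γ` is a branch with equation `g` and `f = g * q`, then along `γ` the hamiltonian vector field of
`f` is `q` times that of `g`, which does not vanish because `γ` is smooth. The other branches being
smooth and transverse to `γ`, the order of `q` along `γ` is `n - 1`; hence `Z₀(H, γ) = n - 1 ≥ 1`
(`vanishingOrder_hamiltonian`). On the other hand `Z₀(F, γ) ≥ ν` since `γ` is smooth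
(`Branch.X_pow_dvd_of_isPullbackField`). So it suffices to show `n ≤ ν + 1`.

Put `G = x F₁ - y F₀` (`radialContraction`), a series of multiplicity at least `ν + 1`.

* If the multiplicity of `G` is `ν + 1`, its leading form vanishes on the tangents of all the
  branches (`homogeneousEval_radialContraction`), which are different lines. A nonzero binary form of degree
  `ν + 1` vanishes on at most `ν + 1` lines (`card_le_of_binaryForm_eq_zero`), so `n ≤ ν + 1`.
* If it is larger, the leading part of `F` is `P * (x ∂/∂x + y ∂/∂y)` with `P` a nonzero form of
  degree `ν - 1` (`homogeneousEval_of_dicritical`). The minimal desingularization of `Γ` is a single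
  blow-up, and the transform of the foliation is transverse to the exceptional divisor away from the
  zeros of `P` (`isUnit_transform_of_dicritical`), so `κ ≥ 1` forces the tangent of the branch to be
  a zero of `P`. This holds for all the branches except at most two, so `n - 2 ≤ ν - 1`.

The leading terms of pullbacks by arcs and by blow-up charts are both computed by
`coeff_subst_X_mul`, since in both cases one composes with a map that vanishes on the divisor `t = 0` or `z = 0`.
-/

open scoped PowerSeries

namespace PlaneFoliation

/-! ### Homogeneous parts of power series and substitutions -/

/-- The value at `v` of the homogeneous part of degree `m` of `f`. -/
noncomputable def homogeneousEval (m : ℕ) (f : MvPowerSeries (Fin 2) ℂ) (v : Fin 2 → ℂ) : ℂ :=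
  ∑ p ∈ Finset.HasAntidiagonal.antidiagonal m,
    MvPowerSeries.coeff (Finsupp.single 0 p.1 + Finsupp.single 1 p.2) f * (v 0 ^ p.1 * v 1 ^ p.2)

theorem finsupp_fin_two_eq (d : Fin 2 →₀ ℕ) :
    d = Finsupp.single 0 (d 0) + Finsupp.single 1 (d 1) := by
  ext i
  fin_cases i <;> simp

theorem degree_fin_two (d : Fin 2 →₀ ℕ) : d.degree = d 0 + d 1 := by
  rw [Finsupp.degree_eq_sum, Fin.sum_univ_two]

section Substitution

variable {τ : Type*} {s : τ} {w : Fin 2 → MvPowerSeries τ ℂ}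

theorem hasSubst_X_mul : MvPowerSeries.HasSubst fun i => MvPowerSeries.X s * w i :=
  MvPowerSeries.hasSubst_of_constantCoeff_zero fun i => by simp

theorem prod_X_mul_pow (d : Fin 2 →₀ ℕ) :
    (d.prod fun i k => (MvPowerSeries.X s * w i) ^ k) =
      MvPowerSeries.X s ^ d.degree * (w 0 ^ d 0 * w 1 ^ d 1) := by
  rw [Finsupp.prod_fintype _ _ (fun i => pow_zero _), Fin.prod_univ_two, degree_fin_two]
  ring

theorem X_pow_dvd_subst {f : MvPowerSeries (Fin 2) ℂ} {m : ℕ} (hf : m ≤ f.order) :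
    MvPowerSeries.X s ^ m ∣ MvPowerSeries.subst (fun i => MvPowerSeries.X s * w i) f := by
  rw [MvPowerSeries.X_pow_dvd_iff]
  intro e he
  rw [MvPowerSeries.coeff_subst hasSubst_X_mul]
  refine finsum_eq_zero_of_forall_eq_zero fun d => ?_
  by_cases hd : d.degree < m
  · rw [MvPowerSeries.coeff_of_lt_order (lt_of_lt_of_le (by exact_mod_cast hd) hf), zero_smul]
  · rw [prod_X_mul_pow, MvPowerSeries.X_pow_dvd_iff.1 (dvd_mul_right _ _) e (by omega), smul_zero]

/-- The leading coefficient along the divisor `X s = 0` of a composition with a map that vanishes on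
this divisor. It applies both to arcs and to blow-up charts. -/
theorem coeff_subst_X_mul {f : MvPowerSeries (Fin 2) ℂ} {m : ℕ} (hf : m ≤ f.order) :
    MvPowerSeries.coeff (Finsupp.single s m)
        (MvPowerSeries.subst (fun i => MvPowerSeries.X s * w i) f) =
      homogeneousEval m f fun i => MvPowerSeries.constantCoeff (w i) := by
  classical
  rw [MvPowerSeries.coeff_subst hasSubst_X_mul,
    finsum_eq_sum_of_support_subset
      (s := (Finset.HasAntidiagonal.antidiagonal m).image fun p : ℕ × ℕ =>
      (Finsupp.single 0 p.1 + Finsupp.single 1 p.2 : Fin 2 →₀ ℕ))]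
  · rw [Finset.sum_image]
    · refine Finset.sum_congr rfl fun p hp => ?_
      have hp' := Finset.HasAntidiagonal.mem_antidiagonal.1 hp
      rw [prod_X_mul_pow, smul_eq_mul, degree_fin_two]
      congr 1
      simp only [Finsupp.add_apply, Finsupp.single_eq_same, Finsupp.single_apply]
      simp only [one_ne_zero, zero_ne_one, if_false, add_zero, zero_add, hp']
      rw [MvPowerSeries.X_pow_eq, MvPowerSeries.coeff_monomial_mul]
      simp
    · intro p _ q _ h
      have h0 := DFunLike.congr_fun h 0
      have h1 := DFunLike.congr_fun h 1
      simp at h0 h1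
      exact Prod.ext h0 h1
  · intro d hd
    rw [Function.mem_support] at hd
    have h1 : ¬ d.degree < m := fun h => hd (by
      rw [MvPowerSeries.coeff_of_lt_order (lt_of_lt_of_le (by exact_mod_cast h) hf), zero_smul])
    have h2 : ¬ m < d.degree := fun h => hd (by
      rw [prod_X_mul_pow, MvPowerSeries.X_pow_dvd_iff.1 (dvd_mul_right _ _) _ (by simpa using h),
        smul_zero])
    have h3 : d.degree = m := by omega
    rw [degree_fin_two] at h3
    simp only [Finset.coe_image, Set.mem_image, Finset.mem_coe,
      Finset.HasAntidiagonal.mem_antidiagonal]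
    exact ⟨(d 0, d 1), h3, (finsupp_fin_two_eq d).symm⟩

end Substitution

/-! ### Zeros of binary forms -/

/-- A nonzero binary form of degree `m` vanishes on at most `m` lines through the origin. -/
theorem card_le_of_binaryForm_eq_zero {ι : Type*} (s : Finset ι) (v : ι → Fin 2 → ℂ) (c : ℕ → ℂ)
    (m : ℕ) (hc : ∃ j ≤ m, c j ≠ 0)
    (hv : (s : Set ι).Pairwise fun i j => v i 0 * v j 1 - v i 1 * v j 0 ≠ 0)
    (hv0 : ∀ i ∈ s, v i ≠ 0)
    (hz : ∀ i ∈ s, ∑ p ∈ Finset.HasAntidiagonal.antidiagonal m,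
      c p.2 * (v i 0 ^ p.1 * v i 1 ^ p.2) = 0) :
    s.card ≤ m := by
  classical
  let P : Polynomial ℂ := ∑ j ∈ Finset.range (m + 1), Polynomial.monomial j (c j)
  have hcoeff : ∀ j, P.coeff j = if j ≤ m then c j else 0 := by
    intro j
    simp only [P, Polynomial.finsetSum_coeff, Polynomial.coeff_monomial]
    simp
  obtain ⟨j₀, hj₀, hcj₀⟩ := hc
  have hP : P ≠ 0 := fun h => hcj₀ (by simpa [h, hj₀] using (hcoeff j₀).symm)
  have hdeg : P.natDegree ≤ m := Polynomial.natDegree_le_iff_coeff_eq_zero.2 fun j hj => by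
    rw [hcoeff, if_neg (by omega)]
  have h1 : (s.filter fun i => v i 0 ≠ 0).card ≤ P.natDegree := by
    refine le_trans ?_ ((Multiset.toFinset_card_le P.roots).trans (Polynomial.card_roots' P))
    refine Finset.card_le_card_of_injOn (fun i => v i 1 / v i 0) ?_ ?_
    · intro i hi
      simp only [Finset.coe_filter, Set.mem_ofPred_eq] at hi
      simp only [Finset.mem_coe, Multiset.mem_toFinset]
      rw [Polynomial.mem_roots hP, Polynomial.IsRoot.def]
      have h := hz i hi.1
      rw [← Finset.Nat.sum_antidiagonal_swap,
        Finset.Nat.sum_antidiagonal_eq_sum_range_succ_mk] at h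
      have h2 : v i 0 ^ m * P.eval (v i 1 / v i 0) = 0 := by
        rw [← h]
        simp only [P, Polynomial.eval_finsetSum, Polynomial.eval_monomial]
        rw [Finset.mul_sum]
        refine Finset.sum_congr rfl fun k hk => ?_
        have hk' : k ≤ m := by simpa [Nat.lt_succ_iff] using hk
        have h3 : v i 0 ^ m = v i 0 ^ (m - k) * v i 0 ^ k := by rw [← pow_add]; congr 1; omega
        rw [h3, div_pow]
        have := hi.2
        simp only [Prod.fst_swap, Prod.snd_swap]
        field_simp
      exact (mul_eq_zero.1 h2).resolve_left (pow_ne_zero _ hi.2)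
    · intro i hi j hj hij
      simp only [Finset.coe_filter, Set.mem_ofPred_eq] at hi hj
      by_contra hne
      refine hv hi.1 hj.1 hne ?_
      have h2 := hi.2
      have h3 := hj.2
      simp only at hij
      rw [div_eq_div_iff h2 h3] at hij
      linear_combination -hij
  have h2 : (s.filter fun i => ¬ v i 0 ≠ 0).card ≤ 1 := by
    refine Finset.card_le_one.2 fun i hi j hj => ?_
    simp only [Finset.mem_filter, not_not] at hi hj
    by_contra hne
    exact hv hi.1 hj.1 hne (by rw [hi.2, hj.2]; ring)
  have h3 := Finset.card_filter_add_card_filter_not (s := s) (fun i => v i 0 ≠ 0)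
  rcases Finset.eq_empty_or_nonempty (s.filter fun i => ¬ v i 0 ≠ 0) with he | ⟨i, hi⟩
  · rw [he, Finset.card_empty] at h3
    omega
  · -- if the line `x = 0` is a zero, the dehomogenized polynomial drops degree
    simp only [Finset.mem_filter, not_not] at hi
    have h4 : v i 1 ≠ 0 := fun h => hv0 i hi.1 (by ext k; fin_cases k <;> simp [h, hi.2])
    have h5 := hz i hi.1
    rw [Finset.sum_eq_single (0, m)] at h5
    · have h6 : c m = 0 := by simpa [h4] using h5
      have h7 : P.natDegree ≤ m - 1 := Polynomial.natDegree_le_iff_coeff_eq_zero.2 fun j hj => by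
        rw [hcoeff]
        split_ifs with h
        · rw [show j = m by omega, h6]
        · rfl
      have h8 : m ≠ 0 := by
        rintro rfl
        exact hcj₀ (by rw [Nat.le_zero.1 hj₀, h6])
      omega
    · rintro ⟨p, q⟩ hp hne
      have hp' := Finset.HasAntidiagonal.mem_antidiagonal.1 hp
      have : p ≠ 0 := by
        rintro rfl
        exact hne (by simp at hp'; simp [hp'])
      simp [hi.2, this]
    · simp

/-! ### Units and divisibility in the ring of convergent power series -/

theorem summable_half_pow_degree :
    Summable fun m : Fin 2 →₀ ℕ => (1 / 2 : ℝ) ^ m.degree := by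
  have h : Summable fun p : ℕ × ℕ => (1 / 2 : ℝ) ^ p.1 * (1 / 2 : ℝ) ^ p.2 :=
    summable_geometric_two.mul_of_nonneg summable_geometric_two (fun _ => by positivity)
      (fun _ => by positivity)
  have hi : Function.Injective fun m : Fin 2 →₀ ℕ => (m 0, m 1) := by
    intro m n hmn
    ext i
    fin_cases i
    · exact congrArg Prod.fst hmn
    · exact congrArg Prod.snd hmn
  refine (h.comp_injective hi).congr fun m => ?_
  simp only [Function.comp, degree_fin_two, pow_add]

/-- Coefficients bounded as in the Cauchy estimates give convergence on a smaller polydisc. -/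
theorem isConvergent_of_bounded {f : MvPowerSeries (Fin 2) ℂ} {s B : ℝ} (hs : 0 < s)
    (h : ∀ m, ‖MvPowerSeries.coeff m f‖ * s ^ m.degree ≤ B) : IsConvergent f := by
  refine ⟨s / 2, by positivity, ?_⟩
  refine Summable.of_nonneg_of_le (fun m => by positivity) (fun m => ?_)
    (summable_half_pow_degree.mul_left B)
  calc _ = ‖MvPowerSeries.coeff m f‖ * s ^ m.degree * (1 / 2) ^ m.degree := by
        rw [div_eq_mul_one_div s, mul_pow]; ring
    _ ≤ _ := by gcongr; exact h m

/-- The nonconstant terms of a convergent series are small on a small polydisc. -/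
theorem exists_radius_sum_le {f : MvPowerSeries (Fin 2) ℂ} (hf : IsConvergent f) {ε : ℝ}
    (hε : 0 < ε) : ∃ s : ℝ, 0 < s ∧ ∀ t : Finset (Fin 2 →₀ ℕ), 0 ∉ t →
      ∑ m ∈ t, ‖MvPowerSeries.coeff m f‖ * s ^ m.degree ≤ ε := by
  obtain ⟨r, hr, h⟩ := hf
  set S := ∑' m : Fin 2 →₀ ℕ, ‖MvPowerSeries.coeff m f‖ * r ^ m.degree
  have hS : 0 ≤ S := tsum_nonneg fun m => by positivity
  have hq : 0 < min 1 (ε / (S + 1)) := by positivity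
  set q := min 1 (ε / (S + 1))
  have hq1 : q ≤ 1 := min_le_left _ _
  have hq2 : q * S ≤ ε := by
    calc q * S ≤ ε / (S + 1) * (S + 1) := by
          gcongr
          · exact min_le_right _ _
          · linarith
      _ = ε := by field_simp
  refine ⟨q * r, by positivity, fun t ht => ?_⟩
  calc _ ≤ ∑ m ∈ t, q * (‖MvPowerSeries.coeff m f‖ * r ^ m.degree) := by
        refine Finset.sum_le_sum fun m hm => ?_
        have hm0 : m.degree ≠ 0 := fun h0 =>
          ht (by rwa [(Finsupp.degree_eq_zero_iff m).1 h0] at hm)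
        have : q ^ m.degree ≤ q := pow_le_of_le_one hq.le hq1 hm0
        calc _ = ‖MvPowerSeries.coeff m f‖ * r ^ m.degree * q ^ m.degree := by
              rw [mul_pow]; ring
          _ ≤ ‖MvPowerSeries.coeff m f‖ * r ^ m.degree * q := by gcongr
          _ = _ := by ring
    _ = q * ∑ m ∈ t, ‖MvPowerSeries.coeff m f‖ * r ^ m.degree := by rw [Finset.mul_sum]
    _ ≤ q * S := by
        gcongr
        exact h.sum_le_tsum t fun m _ => by positivity
    _ ≤ ε := hq2

/-- On a polydisc where the nonconstant terms of `f` are dominated by the constant one, the recursion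
for the coefficients of `f⁻¹` keeps them bounded. -/
theorem isConvergent_inv {f : MvPowerSeries (Fin 2) ℂ} (hf : IsConvergent f)
    (h0 : MvPowerSeries.constantCoeff f ≠ 0) : IsConvergent f⁻¹ := by
  classical
  set c := MvPowerSeries.constantCoeff f
  have hc : 0 < ‖c‖ := norm_pos_iff.2 h0
  obtain ⟨s, hs, hsum⟩ := exists_radius_sum_le hf hc
  have hmul : f * f⁻¹ = 1 := MvPowerSeries.mul_inv_cancel f h0
  have hcoeff0 : MvPowerSeries.coeff 0 f = c := MvPowerSeries.coeff_zero_eq_constantCoeff_apply f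
  refine isConvergent_of_bounded (B := ‖c‖⁻¹) hs fun m => ?_
  induction hn : m.degree using Nat.strong_induction_on generalizing m with
  | _ n ih =>
  subst hn
  have h1 := congrArg (MvPowerSeries.coeff m) hmul
  have hmem : ((0 : Fin 2 →₀ ℕ), m) ∈ Finset.HasAntidiagonal.antidiagonal m := by simp
  rw [MvPowerSeries.coeff_mul, ← Finset.add_sum_erase _ _ hmem, MvPowerSeries.coeff_one,
    hcoeff0] at h1
  split_ifs at h1 with hm
  · subst hm
    have : MvPowerSeries.coeff (0 : Fin 2 →₀ ℕ) f⁻¹ = c⁻¹ := by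
      rw [MvPowerSeries.coeff_zero_eq_constantCoeff_apply, MvPowerSeries.constantCoeff_inv]
    simp [this]
  · -- the recursion for the coefficients of the inverse
    set A := (Finset.HasAntidiagonal.antidiagonal m).erase (0, m)
    have hA : ∀ p ∈ A, p.1 ≠ 0 ∧ p.1 + p.2 = m := by
      intro p hp
      obtain ⟨hp1, hp2⟩ := Finset.mem_erase.1 hp
      rw [Finset.HasAntidiagonal.mem_antidiagonal] at hp2
      refine ⟨fun h => hp1 ?_, hp2⟩
      rw [h, zero_add] at hp2
      exact Prod.ext h hp2
    have h2 : ‖c‖ * (‖MvPowerSeries.coeff m f⁻¹‖ * s ^ m.degree) ≤ ‖c‖ * ‖c‖⁻¹ := by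
      calc _ = ‖c * MvPowerSeries.coeff m f⁻¹‖ * s ^ m.degree := by rw [norm_mul]; ring
        _ = ‖∑ p ∈ A, MvPowerSeries.coeff p.1 f * MvPowerSeries.coeff p.2 f⁻¹‖
              * s ^ m.degree := by
            rw [eq_neg_of_add_eq_zero_left h1, norm_neg]
        _ ≤ (∑ p ∈ A, ‖MvPowerSeries.coeff p.1 f * MvPowerSeries.coeff p.2 f⁻¹‖)
              * s ^ m.degree := by
            gcongr
            exact norm_sum_le _ _
        _ ≤ ∑ p ∈ A, ‖MvPowerSeries.coeff p.1 f‖ * s ^ p.1.degree * ‖c‖⁻¹ := by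
            rw [Finset.sum_mul]
            refine Finset.sum_le_sum fun p hp => ?_
            obtain ⟨hp1, hp2⟩ := hA p hp
            have hd : p.1.degree + p.2.degree = m.degree := by rw [← hp2, map_add]
            have hlt : p.2.degree < m.degree := by
              have : p.1.degree ≠ 0 := fun h => hp1 ((Finsupp.degree_eq_zero_iff _).1 h)
              omega
            have := ih _ hlt p.2 rfl
            calc _ = ‖MvPowerSeries.coeff p.1 f‖ * s ^ p.1.degree
                  * (‖MvPowerSeries.coeff p.2 f⁻¹‖ * s ^ p.2.degree) := by
                  rw [norm_mul, ← hd, pow_add]; ring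
              _ ≤ _ := by gcongr
        _ = (∑ k ∈ A.image Prod.fst, ‖MvPowerSeries.coeff k f‖ * s ^ k.degree) * ‖c‖⁻¹ := by
            rw [Finset.sum_image, Finset.sum_mul]
            intro p hp q hq hpq
            refine Prod.ext hpq ?_
            have h3 := (hA p hp).2.trans (hA q hq).2.symm
            rw [show p.1 = q.1 from hpq] at h3
            exact add_left_cancel h3
        _ ≤ ‖c‖ * ‖c‖⁻¹ := by
            gcongr
            refine hsum _ fun h => ?_
            obtain ⟨p, hp, h⟩ := Finset.mem_image.1 h
            exact (hA p hp).1 h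
    exact le_of_mul_le_mul_left h2 hc

theorem isUnit_of_constantCoeff_ne_zero {f : O₂} (h : MvPowerSeries.constantCoeff f.1 ≠ 0) :
    IsUnit f :=
  IsUnit.of_mul_eq_one ⟨f.1⁻¹, isConvergent_inv f.2 h⟩
    (Subtype.ext (MvPowerSeries.mul_inv_cancel f.1 h))

theorem var_dvd_of_X_dvd {e : Fin 2} {f : O₂} (h : MvPowerSeries.X e ∣ f.1) : var e ∣ f := by
  obtain ⟨g, hg⟩ := h
  obtain ⟨r, hr, hf⟩ := f.2
  have hcoeff : ∀ m, MvPowerSeries.coeff m g =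
      MvPowerSeries.coeff (Finsupp.single e 1 + m) f.1 := fun m => by
    rw [hg, MvPowerSeries.X, MvPowerSeries.coeff_add_monomial_mul, one_mul]
  refine ⟨⟨g, r, hr, ?_⟩, Subtype.ext hg⟩
  have h1 := (hf.comp_injective (add_right_injective (Finsupp.single e 1))).mul_left (1 / r)
  refine h1.congr fun m => ?_
  simp only [Function.comp, hcoeff, map_add, Finsupp.degree_single, pow_add, pow_one]
  field_simp

theorem not_var_dvd_of_isUnit {e : Fin 2} {f : O₂} (hf : IsUnit f) : ¬ var e ∣ f := by
  intro h
  have h1 := (isUnit_of_dvd_unit h hf).map ((MvPowerSeries.constantCoeff (σ := Fin 2)).comp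
    convergentSeries.subtype)
  simp [var] at h1

/-! ### The index of a component of the divisor at a regular transverse point -/

theorem pd_var (i j : Fin 2) : pd i (var j) = if j = i then 1 else 0 := by
  classical
  refine Subtype.ext ?_
  change MvPowerSeries.pderiv ℂ i (MvPowerSeries.X j) = _
  rw [MvPowerSeries.pderiv_X, Pi.single_apply]
  split_ifs <;> simp_all

theorem VectorField.apply_var (X : VectorField) (e : Fin 2) : X.apply (var e) = X e := by
  simp [VectorField.apply, pd_var]

/-- A vector field that is transverse to the divisor at the origin has `κ = 0`. -/
theorem kappa_eq_zero_of_isUnit {Y : VectorField} {e : Fin 2} (h : IsUnit (Y e))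
    (E : Set (Fin 2)) : kappa Y E e = 0 := by
  have h1 : ¬ Y.LeavesInvariant (var e) := by
    rw [VectorField.LeavesInvariant, VectorField.apply_var]
    exact not_var_dvd_of_isUnit h
  have h2 : Ideal.span {var e, Y.apply (var e)} = ⊤ :=
    Ideal.eq_top_of_isUnit_mem _ (Ideal.subset_span (by simp [VectorField.apply_var])) h
  rw [kappa, if_pos h1, tang, h2]
  have : Subsingleton (O₂ ⧸ (⊤ : Ideal O₂)) := Ideal.Quotient.subsingleton_iff.2 rfl
  rw [rank_subsingleton']
  simp

/-! ### Composition with arcs -/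

namespace Arc

/-- The velocity of the arc at the origin. -/
noncomputable def tangent (α : Arc) (i : Fin 2) : ℂ := PowerSeries.coeff 1 (α.coord i)

theorem exists_coord_eq (α : Arc) :
    ∃ w : Fin 2 → ℂ⟦X⟧, (α.coord = fun i => PowerSeries.X * w i) ∧
      ∀ i, PowerSeries.constantCoeff (w i) = α.tangent i := by
  choose w hw using fun i => PowerSeries.X_dvd_iff.2 (α.constantCoeff_eq_zero i)
  refine ⟨w, funext hw, fun i => ?_⟩
  rw [tangent, hw i, ← zero_add 1, PowerSeries.coeff_succ_X_mul,
    PowerSeries.coeff_zero_eq_constantCoeff_apply]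

theorem hasSubst (α : Arc) : MvPowerSeries.HasSubst α.coord :=
  MvPowerSeries.hasSubst_of_constantCoeff_zero α.constantCoeff_eq_zero

theorem X_pow_dvd_subst (α : Arc) {f : MvPowerSeries (Fin 2) ℂ} {m : ℕ} (hf : m ≤ f.order) :
    (PowerSeries.X : ℂ⟦X⟧) ^ m ∣ MvPowerSeries.subst α.coord f := by
  obtain ⟨w, hw, -⟩ := α.exists_coord_eq
  rw [hw]
  exact PlaneFoliation.X_pow_dvd_subst (s := ()) hf

theorem coeff_subst (α : Arc) {f : MvPowerSeries (Fin 2) ℂ} {m : ℕ} (hf : m ≤ f.order) :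
    PowerSeries.coeff m (MvPowerSeries.subst α.coord f : ℂ⟦X⟧) =
      homogeneousEval m f α.tangent := by
  obtain ⟨w, hw, hw'⟩ := α.exists_coord_eq
  have h : α.tangent = fun i => PowerSeries.constantCoeff (w i) := funext fun i => (hw' i).symm
  rw [hw, h]
  exact coeff_subst_X_mul (s := ()) hf

/-- Composition with the arc, as a homomorphism of algebras. -/
noncomputable def pullbackHom (α : Arc) : O₂ →ₐ[ℂ] ℂ⟦X⟧ :=
  (MvPowerSeries.substAlgHom (R := ℂ) α.hasSubst).comp convergentSeries.val

theorem pullback_eq (α : Arc) (f : O₂) : α.pullback f = α.pullbackHom f :=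
  (MvPowerSeries.substAlgHom_apply α.hasSubst f.1).symm

theorem pullback_var (α : Arc) (i : Fin 2) : α.pullback (var i) = α.coord i :=
  MvPowerSeries.subst_X α.hasSubst i

theorem derivative_subst_coe (α : Arc) (p : MvPolynomial (Fin 2) ℂ) :
    PowerSeries.derivative ℂ (MvPowerSeries.subst α.coord (p : MvPowerSeries (Fin 2) ℂ)) =
      ∑ j, MvPowerSeries.subst α.coord (MvPowerSeries.pderiv ℂ j (p : MvPowerSeries (Fin 2) ℂ)) *
        PowerSeries.derivative ℂ (α.coord j) := by
  simp only [← MvPowerSeries.substAlgHom_apply α.hasSubst]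
  induction p using MvPolynomial.induction_on with
  | C a =>
    simp only [MvPolynomial.coe_C, MvPowerSeries.pderiv_C, map_zero, zero_mul,
      Finset.sum_const_zero]
    rw [MvPowerSeries.substAlgHom_apply, MvPowerSeries.subst_C]
    exact PowerSeries.derivative_C
  | add p q hp hq =>
    simp only [MvPolynomial.coe_add, map_add, hp, hq, add_mul, Finset.sum_add_distrib]
  | mul_X p i hp =>
    simp only [MvPolynomial.coe_mul, MvPolynomial.coe_X, map_mul, Derivation.leibniz, hp,
      MvPowerSeries.substAlgHom_X, smul_eq_mul, map_add, add_mul, Finset.sum_add_distrib]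
    congr 1
    · rw [Finset.sum_eq_single i]
      · rw [MvPowerSeries.pderiv_X_self, map_one, mul_one]
      · intro j _ hj
        rw [MvPowerSeries.pderiv_X_of_ne hj.symm, map_zero, mul_zero, zero_mul]
      · simp
    · rw [Finset.mul_sum]
      refine Finset.sum_congr rfl fun j _ => by ring

/-- The chain rule; it follows from the case of polynomials, since modulo any power of the parameter
both sides depend only on a truncation of `f`. -/
theorem derivative_pullback (α : Arc) (f : O₂) :
    PowerSeries.derivative ℂ (α.pullback f) =
      ∑ j, α.pullback (pd j f) * PowerSeries.derivative ℂ (α.coord j) := by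
  change PowerSeries.derivative ℂ (MvPowerSeries.subst α.coord f.1) =
    ∑ j, MvPowerSeries.subst α.coord (MvPowerSeries.pderiv ℂ j f.1) *
      PowerSeries.derivative ℂ (α.coord j)
  ext n
  set p : MvPolynomial (Fin 2) ℂ := MvPowerSeries.truncTotal (n + 2) f.1
  set g : MvPowerSeries (Fin 2) ℂ := f.1 - p
  have hf : f.1 = p + g := by simp [g]
  have hg : ((n + 2 : ℕ) : ℕ∞) ≤ g.order := MvPowerSeries.nat_le_order fun d hd => by
    simp only [g, p, map_sub, MvPolynomial.coeff_coe]
    rw [MvPowerSeries.coeff_truncTotal _ hd, sub_self]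
  have hg' : ∀ j, ((n + 1 : ℕ) : ℕ∞) ≤ (MvPowerSeries.pderiv ℂ j g).order := fun j =>
    MvPowerSeries.nat_le_order fun d hd => by
      rw [MvPowerSeries.coeff_pderiv, MvPowerSeries.coeff_of_lt_order, zero_mul]
      refine lt_of_lt_of_le ?_ hg
      rw [map_add, Finsupp.degree_single]
      exact_mod_cast (by omega : d.degree + 1 < n + 2)
  have h1 : PowerSeries.coeff n
      (PowerSeries.derivative ℂ (MvPowerSeries.subst α.coord g : ℂ⟦X⟧)) = 0 := by
    rw [PowerSeries.coeff_derivative, PowerSeries.X_pow_dvd_iff.1 (α.X_pow_dvd_subst hg) (n + 1)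
      (by omega), zero_mul]
  have h2 : ∀ j, PowerSeries.coeff n ((MvPowerSeries.subst α.coord (MvPowerSeries.pderiv ℂ j g) :
      ℂ⟦X⟧) * PowerSeries.derivative ℂ (α.coord j)) = 0 := fun j =>
    PowerSeries.X_pow_dvd_iff.1 ((α.X_pow_dvd_subst (hg' j)).mul_right _) n (by omega)
  have h3 := congrArg (PowerSeries.coeff n) (α.derivative_subst_coe p)
  simp only [map_sum] at h3
  simp only [hf, map_add, MvPowerSeries.subst_add α.hasSubst, add_mul, map_sum, h1, h2, h3,
    add_zero]

end Arc

theorem tangent_ne_zero_of_mult_eq_one {α : Arc} (h : α.mult = 1) : α.tangent ≠ 0 := by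
  intro h0
  have h1 : ∀ i, 2 ≤ (α.coord i).order := fun i =>
    PowerSeries.nat_le_order _ 2 fun k hk => by
      interval_cases k
      · rw [PowerSeries.coeff_zero_eq_constantCoeff_apply, α.constantCoeff_eq_zero]
      · exact congrFun h0 i
  have h2 : (2 : ℕ∞) ≤ α.mult := le_min (h1 0) (h1 1)
  rw [h] at h2
  exact absurd h2 (by decide)

theorem constantCoeff_derivative_coord (α : Arc) (i : Fin 2) :
    PowerSeries.constantCoeff (PowerSeries.derivative ℂ (α.coord i)) = α.tangent i := by
  rw [← PowerSeries.coeff_zero_eq_constantCoeff_apply, PowerSeries.coeff_derivative]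
  simp [Arc.tangent]

/-- Two vectors orthogonal to the same nonzero vector are proportional; the factor is a power
series if the second vector has a unit coordinate. -/
theorem exists_mul_eq_of_orthogonal {A B u : Fin 2 → ℂ⟦X⟧} (hu : u ≠ 0)
    (hB : ∃ i, PowerSeries.constantCoeff (B i) ≠ 0) (hA : A 0 * u 0 + A 1 * u 1 = 0)
    (hBu : B 0 * u 0 + B 1 * u 1 = 0) : ∃ h, ∀ i, h * B i = A i := by
  have hdet : A 0 * B 1 = A 1 * B 0 := by
    by_contra hne
    have hne' : A 0 * B 1 - A 1 * B 0 ≠ 0 := sub_ne_zero.2 hne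
    apply hu
    have h0 : u 0 = 0 := (mul_eq_zero.1 (show (A 0 * B 1 - A 1 * B 0) * u 0 = 0 by
      linear_combination B 1 * hA - A 1 * hBu)).resolve_left hne'
    have h1 : u 1 = 0 := (mul_eq_zero.1 (show (A 0 * B 1 - A 1 * B 0) * u 1 = 0 by
      linear_combination A 0 * hBu - B 0 * hA)).resolve_left hne'
    ext1 i
    fin_cases i
    exacts [h0, h1]
  obtain ⟨i, hi⟩ := hB
  have hinv : (B i)⁻¹ * B i = 1 := PowerSeries.inv_mul_cancel _ hi
  refine ⟨A i * (B i)⁻¹, fun j => ?_⟩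
  have hij : A i * B j = A j * B i := by
    fin_cases i <;> fin_cases j
    exacts [rfl, hdet, hdet.symm, rfl]
  linear_combination (B i)⁻¹ * hij + A j * hinv

/-! ### Smooth branches -/

namespace Branch

variable {γ η : Branch}

theorem tangent_ne_zero (hγ : γ.IsSmooth) : γ.arc.tangent ≠ 0 :=
  tangent_ne_zero_of_mult_eq_one (γ.arc_mult.trans hγ)

theorem homogeneousEval_one_eqn (v : Fin 2 → ℂ) :
    homogeneousEval 1 γ.eqn.1 v = γ.linear 0 * v 0 + γ.linear 1 * v 1 := by
  rw [homogeneousEval, Finset.Nat.antidiagonal_succ]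
  simp [linear]
  ring

theorem one_le_order_eqn (hγ : γ.IsSmooth) : ((1 : ℕ) : ℕ∞) ≤ γ.eqn.1.order := by
  rw [Nat.cast_one]
  exact hγ.ge

theorem coeff_one_pullback_eqn (hη : η.IsSmooth) (α : Arc) :
    PowerSeries.coeff 1 (α.pullback η.eqn) =
      η.linear 0 * α.tangent 0 + η.linear 1 * α.tangent 1 := by
  rw [← homogeneousEval_one_eqn]
  exact α.coeff_subst (one_le_order_eqn hη)

theorem linear_tangent (hγ : γ.IsSmooth) :
    γ.linear 0 * γ.arc.tangent 0 + γ.linear 1 * γ.arc.tangent 1 = 0 := by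
  rw [← coeff_one_pullback_eqn hγ, γ.pullback_eqn, map_zero]

theorem linear_tangent_ne_zero (hγ : γ.IsSmooth) (h : γ.Transverse η) :
    η.linear 0 * γ.arc.tangent 0 + η.linear 1 * γ.arc.tangent 1 ≠ 0 := by
  intro h1
  have h2 := linear_tangent hγ
  apply tangent_ne_zero hγ
  ext i
  fin_cases i
  · exact (mul_eq_zero.1 (show (γ.linear 0 * η.linear 1 - γ.linear 1 * η.linear 0) *
      γ.arc.tangent 0 = 0 by linear_combination η.linear 1 * h2 - γ.linear 1 * h1)).resolve_left h
  · exact (mul_eq_zero.1 (show (γ.linear 0 * η.linear 1 - γ.linear 1 * η.linear 0) *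
      γ.arc.tangent 1 = 0 by linear_combination γ.linear 0 * h1 - η.linear 0 * h2)).resolve_left h

theorem tangent_det_ne_zero (hγ : γ.IsSmooth) (hη : η.IsSmooth) (h : γ.Transverse η) :
    γ.arc.tangent 0 * η.arc.tangent 1 - γ.arc.tangent 1 * η.arc.tangent 0 ≠ 0 := by
  intro h0
  have h1 := linear_tangent hη
  have h2 := linear_tangent_ne_zero hγ h
  apply tangent_ne_zero hη
  ext i
  fin_cases i
  · exact (mul_eq_zero.1 (show (η.linear 0 * γ.arc.tangent 0 + η.linear 1 * γ.arc.tangent 1) *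
      η.arc.tangent 0 = 0 by
        linear_combination γ.arc.tangent 0 * h1 - η.linear 1 * h0)).resolve_left h2
  · exact (mul_eq_zero.1 (show (η.linear 0 * γ.arc.tangent 0 + η.linear 1 * γ.arc.tangent 1) *
      η.arc.tangent 1 = 0 by
        linear_combination γ.arc.tangent 1 * h1 + η.linear 0 * h0)).resolve_left h2

theorem constantCoeff_pullback_pd (α : Arc) (j : Fin 2) :
    PowerSeries.constantCoeff (α.pullback (pd j γ.eqn)) = γ.linear j := by
  have h := α.coeff_subst (f := (pd j γ.eqn).1) (m := 0) (by simp)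
  rw [PowerSeries.coeff_zero_eq_constantCoeff_apply] at h
  rw [Arc.pullback, h]
  simp only [homogeneousEval, Finset.Nat.antidiagonal_zero, Finset.sum_singleton, pow_zero, mul_one,
    Finsupp.single_zero, add_zero, pd, MvPowerSeries.coeff_pderiv, zero_add, linear]
  simp

theorem linear_ne_zero (hγ : γ.IsSmooth) : γ.linear ≠ 0 := by
  intro h
  have h2 : ((2 : ℕ) : ℕ∞) ≤ γ.eqn.1.order := MvPowerSeries.nat_le_order fun d hd => by
    rcases Nat.lt_or_ge d.degree 1 with h1 | h1
    · refine MvPowerSeries.coeff_of_lt_order (lt_of_lt_of_le ?_ (one_le_order_eqn hγ))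
      exact_mod_cast h1
    · rw [degree_fin_two] at hd h1
      have h3 : d = Finsupp.single 0 1 ∨ d = Finsupp.single 1 1 := by
        rcases Nat.eq_zero_or_pos (d 0) with h0 | h0
        · right
          rw [finsupp_fin_two_eq d, h0, show d 1 = 1 by omega]
          simp
        · left
          rw [finsupp_fin_two_eq d, show d 0 = 1 by omega, show d 1 = 0 by omega]
          simp
      rcases h3 with rfl | rfl
      · exact congrFun h 0
      · exact congrFun h 1
  have h3 : γ.eqn.1.order = 1 := hγ
  rw [h3] at h2
  exact absurd h2 (by decide)

theorem pullback_pd_ne_zero (hγ : γ.IsSmooth) (α : Arc) :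
    (fun j => α.pullback (pd j γ.eqn)) ≠ 0 := by
  intro h
  apply linear_ne_zero hγ
  ext j
  rw [← constantCoeff_pullback_pd α, show α.pullback (pd j γ.eqn) = 0 from congrFun h j, map_zero]
  rfl

theorem exists_tangent_ne_zero (hγ : γ.IsSmooth) : ∃ i, γ.arc.tangent i ≠ 0 := by
  by_contra! h
  exact tangent_ne_zero hγ (funext h)

theorem derivative_orthogonal :
    PowerSeries.derivative ℂ (γ.arc.coord 0) * γ.arc.pullback (pd 0 γ.eqn) +
      PowerSeries.derivative ℂ (γ.arc.coord 1) * γ.arc.pullback (pd 1 γ.eqn) = 0 := by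
  have h := γ.arc.derivative_pullback γ.eqn
  rw [γ.pullback_eqn, map_zero, Fin.sum_univ_two] at h
  rw [h]
  ring

theorem exists_isPullbackField (hγ : γ.IsSmooth) {X : VectorField}
    (hX : γ.arc.pullback (X.apply γ.eqn) = 0) : ∃ h, γ.arc.IsPullbackField X h := by
  obtain ⟨i, hi⟩ := exists_tangent_ne_zero hγ
  refine exists_mul_eq_of_orthogonal (pullback_pd_ne_zero hγ γ.arc)
    (A := fun i => γ.arc.pullback (X i)) (B := fun i => PowerSeries.derivative ℂ (γ.arc.coord i))
    ⟨i, by rwa [constantCoeff_derivative_coord]⟩ ?_ derivative_orthogonal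
  simpa [VectorField.apply, Arc.pullback_eq, Fin.sum_univ_two] using hX

theorem vanishingOrder_eq (hγ : γ.IsSmooth) {X : VectorField} {h : ℂ⟦X⟧}
    (H : γ.arc.IsPullbackField X h) : vanishingOrder X γ.arc = h.order := by
  obtain ⟨i, hi⟩ := exists_tangent_ne_zero hγ
  refine PlaneFoliation.vanishingOrder_eq H ⟨i, fun h0 => hi ?_⟩
  rw [← constantCoeff_derivative_coord, h0, map_zero]

theorem X_pow_dvd_of_isPullbackField (hγ : γ.IsSmooth) {X : VectorField} {h : ℂ⟦X⟧}
    (H : γ.arc.IsPullbackField X h) {m : ℕ} (hm : ∀ i, m ≤ mult (X i)) :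
    PowerSeries.X ^ m ∣ h := by
  obtain ⟨i, hi⟩ := exists_tangent_ne_zero hγ
  rw [← constantCoeff_derivative_coord] at hi
  have h1 : PowerSeries.X ^ m ∣ h * PowerSeries.derivative ℂ (γ.arc.coord i) := by
    rw [H i]
    exact γ.arc.X_pow_dvd_subst (hm i)
  have h2 := h1.mul_right (PowerSeries.derivative ℂ (γ.arc.coord i))⁻¹
  rwa [mul_assoc, PowerSeries.mul_inv_cancel _ hi, mul_one] at h2

theorem pullback_eq_zero_of_dvd {f : O₂} (h : γ.eqn ∣ f) : γ.arc.pullback f = 0 := by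
  obtain ⟨g, rfl⟩ := h
  rw [Arc.pullback_eq, map_mul, ← Arc.pullback_eq, γ.pullback_eqn, zero_mul]

end Branch

/-! ### The hamiltonian foliation -/

theorem order_pullback_eqn_eq_one {γ η : Branch} (hγ : γ.IsSmooth) (hη : η.IsSmooth)
    (h : γ.Transverse η) : (γ.arc.pullback η.eqn).order = 1 := by
  rw [← Nat.cast_one, PowerSeries.order_eq_nat, Branch.coeff_one_pullback_eqn hη]
  refine ⟨Branch.linear_tangent_ne_zero hγ h, fun k hk => ?_⟩
  exact PowerSeries.X_pow_dvd_iff.1 (γ.arc.X_pow_dvd_subst (Branch.one_le_order_eqn hη)) k hk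

theorem order_eq_zero_of_constantCoeff_ne_zero {f : ℂ⟦X⟧}
    (h : PowerSeries.constantCoeff f ≠ 0) : f.order = 0 :=
  PowerSeries.order_zero_of_unit (PowerSeries.isUnit_iff_constantCoeff.2 (isUnit_iff_ne_zero.2 h))

theorem pd_mul (k : Fin 2) (f g : O₂) : pd k (f * g) = f * pd k g + g * pd k f :=
  Subtype.ext ((MvPowerSeries.pderiv ℂ k).leibniz f.1 g.1)

/-- If `γ` is a smooth branch of the curve `γ.eqn * g = 0`, the hamiltonian vector field restricts
to `γ` as `g` times a nonvanishing vector field. -/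
theorem vanishingOrder_hamiltonian_mul {γ : Branch} (hγ : γ.IsSmooth) (g : O₂) :
    vanishingOrder (hamiltonian (γ.eqn * g)) γ.arc = (γ.arc.pullback g).order := by
  have hpd : ∀ k, γ.arc.pullback (pd k (γ.eqn * g)) =
      γ.arc.pullback g * γ.arc.pullback (pd k γ.eqn) := fun k => by
    have h := γ.pullback_eqn
    rw [Arc.pullback_eq] at h
    simp [pd_mul, Arc.pullback_eq, h]
  obtain ⟨h, H⟩ := Branch.exists_isPullbackField hγ (X := hamiltonian (γ.eqn * g)) (by
    have h0 := hpd 0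
    have h1 := hpd 1
    simp only [Arc.pullback_eq] at h0 h1
    simp only [VectorField.apply, hamiltonian, Arc.pullback_eq, Fin.sum_univ_two, map_add, map_mul,
      Matrix.cons_val_zero, Matrix.cons_val_one, map_neg, h0, h1]
    ring)
  rw [Branch.vanishingOrder_eq hγ H]
  have H0 : h * PowerSeries.derivative ℂ (γ.arc.coord 0) =
      γ.arc.pullback g * γ.arc.pullback (pd 1 γ.eqn) := by
    rw [H 0, ← hpd 1]
    rfl
  have H1 : h * PowerSeries.derivative ℂ (γ.arc.coord 1) =
      -(γ.arc.pullback g * γ.arc.pullback (pd 0 γ.eqn)) := by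
    rw [H 1, ← hpd 0]
    simp [hamiltonian, Arc.pullback_eq]
  have hlt := Branch.linear_tangent hγ
  have hord : ∀ {i j : Fin 2}, γ.linear j ≠ 0 → γ.arc.tangent i ≠ 0 →
      (PowerSeries.derivative ℂ (γ.arc.coord i)).order = 0 ∧
        (γ.arc.pullback (pd j γ.eqn)).order = 0 := fun hj hi =>
    ⟨order_eq_zero_of_constantCoeff_ne_zero (by rwa [constantCoeff_derivative_coord]),
      order_eq_zero_of_constantCoeff_ne_zero (by rwa [Branch.constantCoeff_pullback_pd])⟩
  by_cases h1 : γ.linear 1 = 0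
  · have h0 : γ.linear 0 ≠ 0 := fun h0 => Branch.linear_ne_zero hγ (by
      ext i
      fin_cases i
      exacts [h0, h1])
    have t1 : γ.arc.tangent 1 ≠ 0 := fun t1 => Branch.tangent_ne_zero hγ (by
      ext i
      fin_cases i
      exacts [by simpa [h1, h0] using hlt, t1])
    have := congrArg PowerSeries.order H1
    rwa [PowerSeries.order_neg, PowerSeries.order_mul, PowerSeries.order_mul, (hord h0 t1).1,
      (hord h0 t1).2, add_zero, add_zero] at this
  · have t0 : γ.arc.tangent 0 ≠ 0 := fun t0 => Branch.tangent_ne_zero hγ (by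
      ext i
      fin_cases i
      exacts [t0, by simpa [t0, h1] using hlt])
    have := congrArg PowerSeries.order H0
    rwa [PowerSeries.order_mul, PowerSeries.order_mul, (hord h1 t0).1, (hord h1 t0).2, add_zero,
      add_zero] at this

theorem vanishingOrder_hamiltonian (Γ : CurveGerm) (hsmooth : ∀ i, (Γ.branch i).IsSmooth)
    (htrans : Pairwise fun i j => (Γ.branch i).Transverse (Γ.branch j))
    {f : O₂} (hf : Γ.IsReducedEquation f) (i : Fin Γ.n) :
    vanishingOrder (hamiltonian f) (Γ.branch i).arc = (Γ.n - 1 : ℕ) := by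
  classical
  obtain ⟨u, hu⟩ := hf.symm
  have hf' : f = (Γ.branch i).eqn * (u * ∏ j ∈ Finset.univ.erase i, (Γ.branch j).eqn) := by
    rw [← hu, ← Finset.mul_prod_erase Finset.univ (fun j => (Γ.branch j).eqn) (Finset.mem_univ i)]
    ring
  rw [hf', vanishingOrder_hamiltonian_mul (hsmooth i), Arc.pullback_eq, map_mul,
    PowerSeries.order_mul, PowerSeries.order_zero_of_unit (u.isUnit.map _), zero_add, map_prod,
    PowerSeries.order_prod, Finset.sum_congr rfl fun j hj =>
      (congrArg PowerSeries.order ((Branch.arc _).pullback_eq _).symm).trans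
        (order_pullback_eqn_eq_one (hsmooth i) (hsmooth j)
          (htrans (Finset.ne_of_mem_erase hj).symm))]
  simp

/-! ### Transforms by a blow-up -/

namespace Chart

/-- The components of the blow-up map divided by the equation of the exceptional divisor. -/
noncomputable def cofactor : Chart → Fin 2 → O₂
  | .affine c => ![1, var 1 + algebraMap ℂ O₂ c]
  | .vertical => ![var 0, 1]

/-- The direction at which the chart is centred, normalized so that its coordinate of index `exc`
is `1`. -/
noncomputable def direction : Chart → Fin 2 → ℂ
  | .affine c => ![1, c]
  | .vertical => ![0, 1]

theorem map_eq (ch : Chart) (i : Fin 2) : ch.map i = var ch.exc * ch.cofactor i := by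
  rcases ch with c | _ <;> fin_cases i <;> simp [map, exc, cofactor, mul_comm]

theorem constantCoeff_cofactor (ch : Chart) (i : Fin 2) :
    MvPowerSeries.constantCoeff (ch.cofactor i).1 = ch.direction i := by
  rcases ch with c | _ <;> fin_cases i <;>
    simp [cofactor, direction, var, MvPowerSeries.algebraMap_apply]

theorem cofactor_exc (ch : Chart) : ch.cofactor ch.exc = 1 := by
  rcases ch with c | _ <;> simp [cofactor, exc]

theorem direction_exc (ch : Chart) : ch.direction ch.exc = 1 := by
  rcases ch with c | _ <;> simp [direction, exc]

theorem pullback_def (ch : Chart) (f : O₂) : ch.pullback f =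
    MvPowerSeries.subst (fun i => MvPowerSeries.X ch.exc * (ch.cofactor i).1) f.1 := by
  rw [pullback]
  congr 1
  ext1 i
  rw [map_eq]
  rfl

theorem X_pow_dvd_pullback (ch : Chart) {f : O₂} {m : ℕ} (hf : m ≤ mult f) :
    MvPowerSeries.X ch.exc ^ m ∣ ch.pullback f := by
  rw [pullback_def]
  exact X_pow_dvd_subst hf

theorem coeff_pullback (ch : Chart) {f : O₂} {m : ℕ} (hf : m ≤ mult f) :
    MvPowerSeries.coeff (Finsupp.single ch.exc m) (ch.pullback f) =
      homogeneousEval m f.1 ch.direction := by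
  rw [pullback_def, coeff_subst_X_mul hf]
  simp only [constantCoeff_cofactor]

theorem hasSubst (ch : Chart) : MvPowerSeries.HasSubst fun i => (ch.map i).1 := by
  have h : (fun i => (ch.map i).1) = fun i => MvPowerSeries.X ch.exc * (ch.cofactor i).1 := by
    ext1 i
    rw [map_eq]
    rfl
  rw [h]
  exact hasSubst_X_mul

theorem pullback_var (ch : Chart) (i : Fin 2) :
    ch.pullback (var i) = (ch.map i).1 := MvPowerSeries.subst_X ch.hasSubst i

theorem pullback_mul (ch : Chart) (f g : O₂) :
    ch.pullback (f * g) = ch.pullback f * ch.pullback g := MvPowerSeries.subst_mul ch.hasSubst _ _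

theorem pullback_sub (ch : Chart) (f g : O₂) :
    ch.pullback (f - g) = ch.pullback f - ch.pullback g := MvPowerSeries.subst_sub ch.hasSubst _ _

variable {ch : Chart} {α β : Arc}

theorem ArcTransform.coord_eq (h : ch.ArcTransform α β) (i : Fin 2) :
    α.coord i = β.coord ch.exc * β.pullback (ch.cofactor i) := by
  rw [h i, map_eq, Arc.pullback_eq, map_mul, ← Arc.pullback_eq, Arc.pullback_var, Arc.pullback_eq]

theorem ArcTransform.tangent_eq (h : ch.ArcTransform α β) (i : Fin 2) :
    α.tangent i = β.tangent ch.exc * ch.direction i := by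
  have h1 : PowerSeries.constantCoeff (β.pullback (ch.cofactor i)) = ch.direction i := by
    rw [← PowerSeries.coeff_zero_eq_constantCoeff_apply, Arc.pullback,
      β.coeff_subst (m := 0) (by simp), ← constantCoeff_cofactor]
    simp [homogeneousEval]
  obtain ⟨w, hw, hw'⟩ := β.exists_coord_eq
  rw [← hw', ← h1, Arc.tangent, h.coord_eq, hw, mul_assoc, ← zero_add 1,
    PowerSeries.coeff_succ_X_mul, PowerSeries.coeff_zero_eq_constantCoeff_apply, map_mul]

theorem ArcTransform.order_exc (h : ch.ArcTransform α β) : (β.coord ch.exc).order = α.mult := by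
  have h0 : β.coord ch.exc = α.coord ch.exc := by
    rw [h.coord_eq, cofactor_exc, Arc.pullback_eq, map_one, mul_one]
  have h1 : ∀ i, (β.coord ch.exc).order ≤ (α.coord i).order := fun i => by
    rw [h.coord_eq, PowerSeries.order_mul]
    exact le_self_add
  refine le_antisymm (le_min (h1 0) (h1 1)) ?_
  rw [h0, Arc.mult]
  rcases ch with c | _
  · exact min_le_left _ _
  · exact min_le_right _ _

end Chart

/-- Cancellation of powers of the equation `X e = 0` of the exceptional divisor: the multiplicity
of the pulled back vector field along the divisor is exactly `ν + 1`. -/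
theorem constantCoeff_ne_zero_of_dicritical {e : Fin 2}
    {A B C Ye Yo : MvPowerSeries (Fin 2) ℂ} {k ν : ℕ}
    (h1 : MvPowerSeries.X e * A = MvPowerSeries.X e ^ k * Ye)
    (h2 : MvPowerSeries.X e * B = MvPowerSeries.X e ^ k * (Ye * C + MvPowerSeries.X e * Yo))
    (hdvd : MvPowerSeries.X e ^ (ν + 2) ∣ MvPowerSeries.X e * B - MvPowerSeries.X e * C * A)
    (hA : MvPowerSeries.X e ^ ν ∣ A) (hA0 : MvPowerSeries.coeff (Finsupp.single e ν) A ≠ 0)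
    (hY : ¬ (MvPowerSeries.X e ∣ Ye ∧ MvPowerSeries.X e ∣ Yo)) :
    MvPowerSeries.constantCoeff Ye ≠ 0 := by
  set z : MvPowerSeries (Fin 2) ℂ := MvPowerSeries.X e
  have hz : z ≠ 0 := fun h => by
    simpa [z, MvPowerSeries.coeff_X] using congrArg (MvPowerSeries.coeff (Finsupp.single e 1)) h
  have hcancel : ∀ {m l : ℕ} {G : MvPowerSeries (Fin 2) ℂ}, l < m → z ^ m ∣ z ^ l * G → z ∣ G := by
    intro m l G hlm h
    have h3 : z ^ l * z ∣ z ^ l * G := (pow_succ z l ▸ pow_dvd_pow z hlm).trans h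
    exact (mul_dvd_mul_iff_left (pow_ne_zero l hz)).1 h3
  have hYo : z ^ (ν + 2) ∣ z ^ (k + 1) * Yo := by
    have : z * B - z * C * A = z ^ (k + 1) * Yo := by
      linear_combination h2 - C * h1
    rwa [this] at hdvd
  have hYe : z ^ (ν + 1) ∣ z ^ k * Ye := by
    rw [← h1, pow_succ']
    exact mul_dvd_mul_left z hA
  rcases lt_trichotomy k (ν + 1) with hk | rfl | hk
  · exact absurd ⟨hcancel hk hYe, hcancel (by omega) hYo⟩ hY
  · have h3 : A = z ^ ν * Ye := by
      refine mul_left_cancel₀ hz ?_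
      rw [h1]
      ring
    rw [h3, MvPowerSeries.X_pow_eq, MvPowerSeries.coeff_monomial_mul] at hA0
    simpa using hA0
  · refine absurd ?_ hA0
    obtain ⟨l, rfl⟩ : ∃ l, k = l + 1 := ⟨k - 1, by omega⟩
    have h3 : A = z ^ l * Ye := by
      refine mul_left_cancel₀ hz ?_
      rw [h1]
      ring
    rw [h3]
    exact MvPowerSeries.X_pow_dvd_iff.1 (dvd_mul_right _ _) _ (by simpa using hk)

/-- The contraction of the vector field with `x dy - y dx`. Its homogeneous part of degree
`ν₀(X) + 1` is the tangent cone of the foliation, and vanishes when the exceptional divisor of the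
blow-up is not invariant. -/
noncomputable def radialContraction (X : VectorField) : O₂ := var 0 * X 1 - var 1 * X 0

/-- In the dicritical case, the strict transform of the foliation is transverse to the exceptional
divisor at the points that are not zeros of the leading part of the vector field. -/
theorem isUnit_transform_of_dicritical {X Y : VectorField} {ch : Chart} {ν : ℕ}
    (hν : ∀ i, ν ≤ mult (X i)) (hX : ((ν + 2 : ℕ) : ℕ∞) ≤ mult (radialContraction X))
    (h : ch.FieldTransform X Y) (h0 : homogeneousEval ν (X ch.exc).1 ch.direction ≠ 0) :
    IsUnit (Y ch.exc) := by
  obtain ⟨⟨k, hk⟩, hY⟩ := h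
  have hdvd := ch.X_pow_dvd_pullback hX
  rw [radialContraction, Chart.pullback_sub, Chart.pullback_mul, Chart.pullback_mul,
    Chart.pullback_var, Chart.pullback_var] at hdvd
  rw [← ch.coeff_pullback (hν _)] at h0
  refine isUnit_of_constantCoeff_ne_zero ?_
  rcases ch with c | _
  · have hpd : ∀ i, pd i (algebraMap ℂ O₂ c) = 0 := fun i => Subtype.ext MvPowerSeries.pderiv_C
    have hadd : ∀ i (f g : O₂), pd i (f + g) = pd i f + pd i g := fun i f g =>
      Subtype.ext (map_add (MvPowerSeries.pderiv ℂ i) f.1 g.1)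
    have h2 : ∑ j, Y j * pd j ((Chart.affine c).map 0) = Y 0 := by
      simp [Chart.map, pd_var]
    have h3 : ∑ j, Y j * pd j ((Chart.affine c).map 1) =
        Y 0 * (var 1 + algebraMap ℂ O₂ c) + var 0 * Y 1 := by
      simp [Chart.map, Fin.sum_univ_two, pd_mul, pd_var, hadd, hpd, mul_comm]
    refine constantCoeff_ne_zero_of_dicritical (e := 0) (k := k) (ν := ν) (Yo := (Y 1).1)
      (A := (Chart.affine c).pullback (X 0)) (B := (Chart.affine c).pullback (X 1))
      (C := (var 1 + algebraMap ℂ O₂ c : O₂).1) ((hk 0).trans ?_) ((hk 1).trans ?_) hdvd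
      (Chart.X_pow_dvd_pullback _ (hν 0)) h0 ?_
    · rw [h2]
      rfl
    · rw [h3]
      rfl
    · rintro ⟨h1, h2⟩
      exact hY fun j => by
        fin_cases j
        exacts [var_dvd_of_X_dvd h1, var_dvd_of_X_dvd h2]
  · have h2 : ∑ j, Y j * pd j (Chart.vertical.map 1) = Y 1 := by
      simp [Chart.map, pd_var]
    have h3 : ∑ j, Y j * pd j (Chart.vertical.map 0) = Y 1 * var 0 + var 1 * Y 0 := by
      simp [Chart.map, Fin.sum_univ_two, pd_mul, pd_var, mul_comm, add_comm]
    refine constantCoeff_ne_zero_of_dicritical (e := 1) (k := k) (ν := ν) (Yo := (Y 0).1)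
      (A := Chart.vertical.pullback (X 1)) (B := Chart.vertical.pullback (X 0))
      (C := (var 0 : O₂).1) ((hk 1).trans ?_) ((hk 0).trans ?_) ?_
      (Chart.X_pow_dvd_pullback _ (hν 1)) h0 ?_
    · rw [h2]
      rfl
    · rw [h3]
      rfl
    · rw [← dvd_neg, neg_sub, mul_comm (MvPowerSeries.X 1) (var 0 : O₂).1]
      exact hdvd
    · rintro ⟨h1, h2⟩
      exact hY fun j => by
        fin_cases j
        exacts [var_dvd_of_X_dvd h2, var_dvd_of_X_dvd h1]

/-! ### The end points of the desingularization -/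

theorem excDivisor_singleton (ch : Chart) : excDivisor [ch] = {ch.exc} := by
  rcases ch with c | _ <;> simp [excDivisor, Chart.totalTransform, Chart.exc]

/-- A single blow-up desingularizes a curve with smooth and pairwise transverse branches. -/
theorem CurveGerm.resolvedAt_singleton {Γ : CurveGerm} (hsmooth : ∀ i, (Γ.branch i).IsSmooth)
    (htrans : Pairwise fun i j => (Γ.branch i).Transverse (Γ.branch j)) {i : Fin Γ.n} {ch : Chart}
    {β : Arc} (h : ch.ArcTransform (Γ.branch i).arc β) : Γ.ResolvedAt i [ch] := by
  refine ⟨⟨ch.exc, β, excDivisor_singleton ch, ⟨β, h, rfl⟩, ?_⟩, ?_⟩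
  · rw [h.order_exc, (Γ.branch i).arc_mult]
    exact hsmooth i
  · rintro j hj ⟨_, β', h', -⟩
    refine Branch.tangent_det_ne_zero (hsmooth i) (hsmooth j) (htrans hj.symm) ?_
    rw [h.tangent_eq, h.tangent_eq, h'.tangent_eq, h'.tangent_eq]
    ring

/-- The end point of a branch lies on the first exceptional divisor, so `κ` is computed in a single
chart. -/
theorem CurveGerm.KappaPositive.exists_chart {Γ : CurveGerm} {X : VectorField} {i : Fin Γ.n}
    (h : Γ.KappaPositive X i) (hsmooth : ∀ i, (Γ.branch i).IsSmooth)
    (htrans : Pairwise fun i j => (Γ.branch i).Transverse (Γ.branch j)) :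
    ∃ (ch : Chart) (β : Arc) (Y : VectorField), ch.ArcTransform (Γ.branch i).arc β ∧
      ch.FieldTransform X Y ∧ 1 ≤ kappa Y {ch.exc} ch.exc := by
  obtain ⟨w, e, Y, ⟨⟨⟨_, β, -, hβ, -⟩, -⟩, hmin⟩, hE, hY, hκ⟩ := h
  rcases w with _ | ⟨ch, w⟩
  · exact absurd hE (Set.singleton_ne_empty e).symm
  obtain ⟨β₁, hβ₁, -⟩ := hβ
  have hw : w = [] := by
    by_contra hne
    refine hmin [ch] ⟨w, rfl⟩ (fun h => hne ?_) (resolvedAt_singleton hsmooth htrans hβ₁)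
    simpa using h.symm
  subst hw
  obtain ⟨Y₁, hY₁, rfl⟩ := hY
  rw [excDivisor_singleton] at hE hκ
  obtain rfl := Set.singleton_injective hE
  exact ⟨ch, β₁, _, hβ₁, hY₁, hκ⟩

/-! ### Bounding the number of branches by the multiplicity of the foliation -/

theorem succ_le_order_of_coeff_eq_zero {f : MvPowerSeries (Fin 2) ℂ} {m : ℕ} (hf : m ≤ f.order)
    (h : ∀ p q, p + q = m →
      MvPowerSeries.coeff (Finsupp.single 0 p + Finsupp.single 1 q) f = 0) :
    ((m + 1 : ℕ) : ℕ∞) ≤ f.order :=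
  MvPowerSeries.nat_le_order fun d hd => by
    rcases Nat.lt_succ_iff_lt_or_eq.1 hd with h1 | h1
    · exact MvPowerSeries.coeff_of_lt_order (lt_of_lt_of_le (by exact_mod_cast h1) hf)
    · rw [finsupp_fin_two_eq d]
      exact h _ _ (by rw [← degree_fin_two, h1])

theorem exists_multiplicity {X : VectorField} (hX : X.SingularSetIsolated) :
    ∃ ν : ℕ, (∀ i, ν ≤ mult (X i)) ∧ ¬ ∀ i, ((ν + 1 : ℕ) : ℕ∞) ≤ mult (X i) := by
  have hne : min (mult (X 0)) (mult (X 1)) ≠ ⊤ := by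
    intro h
    have h0 : ∀ i, X i = 0 := fun i => by
      have : mult (X i) = ⊤ := by
        fin_cases i
        exacts [(min_eq_top.1 h).1, (min_eq_top.1 h).2]
      exact Subtype.ext (MvPowerSeries.order_eq_top_iff.1 this)
    exact not_var_dvd_of_isUnit (e := 0) (hX (d := var 0) (by simp [h0]) (by simp [h0])) dvd_rfl
  obtain ⟨ν, hν⟩ := ENat.ne_top_iff_exists.1 hne
  refine ⟨ν, fun i => ?_, fun h => ?_⟩
  · rw [hν]
    fin_cases i
    exacts [min_le_left _ _, min_le_right _ _]
  · have h1 := le_min (h 0) (h 1)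
    rw [← hν] at h1
    exact absurd (Nat.cast_le.1 h1) (by omega)

theorem le_mult_radialContraction {X : VectorField} {ν : ℕ} (hν : ∀ i, ν ≤ mult (X i)) :
    ((ν + 1 : ℕ) : ℕ∞) ≤ mult (radialContraction X) := by
  have h : ∀ i j, ((ν + 1 : ℕ) : ℕ∞) ≤ (MvPowerSeries.X i * (X j).1).order := fun i j => by
    refine le_trans ?_ MvPowerSeries.le_order_mul
    have h1 : (1 : ℕ∞) ≤ (MvPowerSeries.X i : MvPowerSeries (Fin 2) ℂ).order :=
      MvPowerSeries.one_le_order_iff_constCoeff_eq_zero.2 (by simp)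
    rw [Nat.cast_add, Nat.cast_one, add_comm]
    exact add_le_add h1 (hν j)
  have h2 := MvPowerSeries.min_order_le_add (f := MvPowerSeries.X 0 * (X 1).1)
    (g := -(MvPowerSeries.X 1 * (X 0).1))
  rw [MvPowerSeries.order_neg, ← sub_eq_add_neg] at h2
  exact (le_min (h 0 1) (h 1 0)).trans h2

/-- The tangent of a smooth invariant branch belongs to the tangent cone of the foliation: along the
branch, the contraction is a multiple of `α₀ α₁' - α₁ α₀'`, which vanishes to order `2`. -/
theorem homogeneousEval_radialContraction {γ : Branch} (hγ : γ.IsSmooth) {X : VectorField}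
    (hX : X.LeavesInvariant γ.eqn) {ν : ℕ} (hν : ∀ i, ν ≤ mult (X i)) :
    homogeneousEval (ν + 1) (radialContraction X).1 γ.arc.tangent = 0 := by
  obtain ⟨h, H⟩ := Branch.exists_isPullbackField hγ (Branch.pullback_eq_zero_of_dvd hX)
  obtain ⟨k, hk⟩ := Branch.X_pow_dvd_of_isPullbackField hγ H hν
  obtain ⟨w, hw, -⟩ := γ.arc.exists_coord_eq
  have h1 : γ.arc.pullback (radialContraction X) =
      γ.arc.coord 0 * γ.arc.pullback (X 1) - γ.arc.coord 1 * γ.arc.pullback (X 0) := by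
    rw [← Arc.pullback_var, ← Arc.pullback_var]
    simp only [Arc.pullback_eq, radialContraction, map_sub, map_mul]
  have h2 : γ.arc.pullback (radialContraction X) = PowerSeries.X ^ (ν + 2) *
      (k * (w 0 * PowerSeries.derivative ℂ (w 1) - w 1 * PowerSeries.derivative ℂ (w 0))) := by
    rw [h1, ← H 0, ← H 1, hw, hk]
    simp only [Derivation.leibniz, PowerSeries.derivative_X, smul_eq_mul]
    ring
  rw [← γ.arc.coeff_subst (le_mult_radialContraction hν)]
  exact PowerSeries.X_pow_dvd_iff.1 (Dvd.intro _ h2.symm) _ (by omega)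

theorem coeff_radialContraction (X : VectorField) (p q : ℕ) :
    MvPowerSeries.coeff (Finsupp.single 0 p + Finsupp.single 1 q) (radialContraction X).1 =
      (if 1 ≤ p then
        MvPowerSeries.coeff (Finsupp.single 0 (p - 1) + Finsupp.single 1 q) (X 1).1 else 0) -
      (if 1 ≤ q then
        MvPowerSeries.coeff (Finsupp.single 0 p + Finsupp.single 1 (q - 1)) (X 0).1 else 0) := by
  have h0 : ∀ g : MvPowerSeries (Fin 2) ℂ,
      MvPowerSeries.coeff (Finsupp.single 0 p + Finsupp.single 1 q) (MvPowerSeries.X 0 * g) =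
        if 1 ≤ p then
          MvPowerSeries.coeff (Finsupp.single 0 (p - 1) + Finsupp.single 1 q) g else 0 := by
    intro g
    rw [MvPowerSeries.X, MvPowerSeries.coeff_monomial_mul, one_mul]
    refine if_congr ?_ (congrArg (fun d => MvPowerSeries.coeff d g) ?_) rfl
    · simp [Finsupp.single_le_iff]
    · ext i
      fin_cases i <;> simp
  have h1 : ∀ g : MvPowerSeries (Fin 2) ℂ,
      MvPowerSeries.coeff (Finsupp.single 0 p + Finsupp.single 1 q) (MvPowerSeries.X 1 * g) =
        if 1 ≤ q then
          MvPowerSeries.coeff (Finsupp.single 0 p + Finsupp.single 1 (q - 1)) g else 0 := by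
    intro g
    rw [MvPowerSeries.X, MvPowerSeries.coeff_monomial_mul, one_mul]
    refine if_congr ?_ (congrArg (fun d => MvPowerSeries.coeff d g) ?_) rfl
    · simp [Finsupp.single_le_iff]
    · ext i
      fin_cases i <;> simp
  rw [← h0, ← h1, ← map_sub]
  rfl

/-- In the nondicritical case, the tangents of the branches are distinct zeros of the tangent cone,
a nonzero form of degree `ν + 1`. -/
theorem card_le_of_not_dicritical {Γ : CurveGerm} {X : VectorField}
    (hsmooth : ∀ i, (Γ.branch i).IsSmooth)
    (htrans : Pairwise fun i j => (Γ.branch i).Transverse (Γ.branch j)) (hΓ : Γ.IsInvariant X)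
    {ν : ℕ} (hν : ∀ i, ν ≤ mult (X i))
    (hX : ¬ ((ν + 2 : ℕ) : ℕ∞) ≤ mult (radialContraction X)) : Γ.n ≤ ν + 1 := by
  have h := card_le_of_binaryForm_eq_zero Finset.univ (fun i => (Γ.branch i).arc.tangent)
    (fun q => MvPowerSeries.coeff (Finsupp.single 0 (ν + 1 - q) + Finsupp.single 1 q)
      (radialContraction X).1) (ν + 1) ?_
    (fun i _ j _ hij => Branch.tangent_det_ne_zero (hsmooth i) (hsmooth j) (htrans hij))
    (fun i _ => Branch.tangent_ne_zero (hsmooth i)) ?_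
  · simpa using h
  · by_contra! h
    refine hX (succ_le_order_of_coeff_eq_zero (le_mult_radialContraction hν) fun p q hpq => ?_)
    rw [← h q (by omega), ← hpq, Nat.add_sub_cancel]
  · intro i _
    rw [← homogeneousEval_radialContraction (hsmooth i) (hΓ i) hν, homogeneousEval]
    refine Finset.sum_congr rfl fun p hp => ?_
    rw [← Finset.HasAntidiagonal.mem_antidiagonal.1 hp, Nat.add_sub_cancel]

theorem coeff_radialContraction_eq_zero {X : VectorField} {m p q : ℕ}
    (hX : ((m + 1 : ℕ) : ℕ∞) ≤ mult (radialContraction X)) (h : p + q = m) :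
    MvPowerSeries.coeff (Finsupp.single 0 p + Finsupp.single 1 q) (radialContraction X).1 = 0 := by
  refine MvPowerSeries.coeff_of_lt_order (lt_of_lt_of_le ?_ hX)
  rw [map_add, Finsupp.degree_single, Finsupp.degree_single]
  exact_mod_cast (by omega : p + q < m + 1)

/-- The coefficient of `x ^ (μ - q) * y ^ q` in the form `P` of degree `μ` such that, in the
dicritical case, `P * (x ∂/∂x + y ∂/∂y)` is the leading part of `X`. -/
noncomputable def radialCoeff (X : VectorField) (μ q : ℕ) : ℂ :=
  MvPowerSeries.coeff (Finsupp.single 0 (μ - q + 1) + Finsupp.single 1 q) (X 0).1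

/-- The leading part of a dicritical vector field is a multiple of the radial vector field. -/
theorem homogeneousEval_of_dicritical {X : VectorField} {μ : ℕ}
    (hX : ((μ + 3 : ℕ) : ℕ∞) ≤ mult (radialContraction X)) (v : Fin 2 → ℂ) (i : Fin 2) :
    homogeneousEval (μ + 1) (X i).1 v =
      v i * ∑ p ∈ Finset.HasAntidiagonal.antidiagonal μ,
        radialCoeff X μ p.2 * (v 0 ^ p.1 * v 1 ^ p.2) := by
  fin_cases i
  · have h := coeff_radialContraction_eq_zero (p := 0) (q := μ + 2) hX (by omega)
    rw [coeff_radialContraction] at h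
    simp only [homogeneousEval, Finset.Nat.antidiagonal_succ, Finset.sum_cons, Finset.sum_map]
    have h' : MvPowerSeries.coeff (Finsupp.single 0 0 + Finsupp.single 1 (μ + 1)) (X 0).1 = 0 := by
      simpa using h
    simp only [Fin.zero_eta, h', zero_mul, zero_add, Finset.mul_sum]
    refine Finset.sum_congr rfl fun p hp => ?_
    rw [radialCoeff, ← Finset.HasAntidiagonal.mem_antidiagonal.1 hp, Nat.add_sub_cancel]
    simp only [Function.Embedding.coe_prodMap, Function.Embedding.coeFn_mk, Prod.map,
      Function.Embedding.refl_apply, Nat.succ_eq_add_one, pow_succ]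
    ring
  · have h := coeff_radialContraction_eq_zero (p := μ + 2) (q := 0) hX (by omega)
    rw [coeff_radialContraction] at h
    simp only [homogeneousEval, Finset.Nat.antidiagonal_succ', Finset.sum_cons, Finset.sum_map]
    have h' : MvPowerSeries.coeff (Finsupp.single 0 (μ + 1) + Finsupp.single 1 0) (X 1).1 = 0 := by
      simpa using h
    simp only [Fin.mk_one, h', zero_mul, zero_add, Finset.mul_sum]
    refine Finset.sum_congr rfl fun p hp => ?_
    have hp' := Finset.HasAntidiagonal.mem_antidiagonal.1 hp
    have h2 := coeff_radialContraction_eq_zero (p := p.1 + 1) (q := p.2 + 1) hX (by omega)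
    rw [coeff_radialContraction, if_pos (by omega), if_pos (by omega), Nat.add_sub_cancel,
      Nat.add_sub_cancel, sub_eq_zero] at h2
    rw [radialCoeff, ← hp', Nat.add_sub_cancel]
    simp only [Function.Embedding.coe_prodMap, Function.Embedding.coeFn_mk, Prod.map,
      Function.Embedding.refl_apply, Nat.succ_eq_add_one, pow_succ, h2]
    ring

/-- If `P` vanished, so would the leading part of `X`, against the choice of its degree. -/
theorem exists_radialCoeff_ne_zero {X : VectorField} {μ : ℕ}
    (hX : ((μ + 3 : ℕ) : ℕ∞) ≤ mult (radialContraction X))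
    (hν : ∀ i, ((μ + 1 : ℕ) : ℕ∞) ≤ mult (X i))
    (hν' : ¬ ∀ i, ((μ + 1 + 1 : ℕ) : ℕ∞) ≤ mult (X i)) : ∃ q ≤ μ, radialCoeff X μ q ≠ 0 := by
  by_contra! h
  have h0 : ∀ p q, p + q = μ + 1 →
      MvPowerSeries.coeff (Finsupp.single 0 p + Finsupp.single 1 q) (X 0).1 = 0 := by
    intro p q hpq
    rcases p with _ | p
    · have h2 := coeff_radialContraction_eq_zero (p := 0) (q := q + 1) hX (by omega)
      rw [coeff_radialContraction] at h2
      simpa using h2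
    · rw [← h q (by omega), radialCoeff, show μ - q + 1 = p + 1 by omega]
  refine hν' fun i => succ_le_order_of_coeff_eq_zero (hν i) fun p q hpq => ?_
  fin_cases i
  · exact h0 p q hpq
  · have h2 := coeff_radialContraction_eq_zero (p := p + 1) (q := q) hX (by omega)
    rw [coeff_radialContraction, if_pos (by omega), Nat.add_sub_cancel] at h2
    split_ifs at h2 with hq
    · rw [h0 (p + 1) (q - 1) (by omega), sub_zero] at h2
      exact h2
    · rw [sub_zero] at h2
      exact h2

/-- In the dicritical case, a branch with `κ ≥ 1` meets the exceptional divisor at a point where the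
foliation is not transverse to the divisor, so its tangent is a zero of the form `P`. -/
theorem sum_radialCoeff_eq_zero {Γ : CurveGerm} {X : VectorField}
    (hsmooth : ∀ i, (Γ.branch i).IsSmooth)
    (htrans : Pairwise fun i j => (Γ.branch i).Transverse (Γ.branch j)) {μ : ℕ}
    (hν : ∀ i, ((μ + 1 : ℕ) : ℕ∞) ≤ mult (X i))
    (hX : ((μ + 3 : ℕ) : ℕ∞) ≤ mult (radialContraction X)) {i : Fin Γ.n}
    (hi : Γ.KappaPositive X i) :
    ∑ p ∈ Finset.HasAntidiagonal.antidiagonal μ, radialCoeff X μ p.2 *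
      ((Γ.branch i).arc.tangent 0 ^ p.1 * (Γ.branch i).arc.tangent 1 ^ p.2) = 0 := by
  obtain ⟨ch, β, Y, hβ, hY, hκ⟩ := hi.exists_chart hsmooth htrans
  have h0 : homogeneousEval (μ + 1) (X ch.exc).1 ch.direction = 0 := by
    by_contra h0
    rw [kappa_eq_zero_of_isUnit (isUnit_transform_of_dicritical hν hX hY h0)] at hκ
    exact absurd hκ (by decide)
  rw [homogeneousEval_of_dicritical hX, Chart.direction_exc, one_mul] at h0
  -- the tangent is proportional to the direction of the chart, and the form is homogeneous
  rw [← mul_zero (β.tangent ch.exc ^ μ), ← h0, Finset.mul_sum]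
  refine Finset.sum_congr rfl fun p hp => ?_
  rw [hβ.tangent_eq, hβ.tangent_eq, ← Finset.HasAntidiagonal.mem_antidiagonal.1 hp]
  ring

/-- In the dicritical case, the tangents of the branches with `κ ≥ 1` are distinct zeros of a nonzero
form of degree `ν - 1`, and at most two branches remain. -/
theorem card_le_of_dicritical {Γ : CurveGerm} {X : VectorField}
    (hsmooth : ∀ i, (Γ.branch i).IsSmooth)
    (htrans : Pairwise fun i j => (Γ.branch i).Transverse (Γ.branch j)) {N : Finset (Fin Γ.n)}
    (hN : N.card ≤ 2) (hκ : ∀ i, i ∉ N → Γ.KappaPositive X i)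
    {ν : ℕ} (hν : ∀ i, ν ≤ mult (X i)) (hν' : ¬ ∀ i, ((ν + 1 : ℕ) : ℕ∞) ≤ mult (X i))
    (hX : ((ν + 2 : ℕ) : ℕ∞) ≤ mult (radialContraction X)) : Γ.n ≤ ν + 1 := by
  rcases ν with _ | μ
  · -- a nonsingular vector field is not dicritical
    refine absurd (fun i => succ_le_order_of_coeff_eq_zero (hν i) fun p q hpq => ?_) hν'
    obtain ⟨rfl, rfl⟩ : p = 0 ∧ q = 0 := by omega
    fin_cases i
    · have h := coeff_radialContraction_eq_zero (p := 0) (q := 1) hX rfl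
      rw [coeff_radialContraction] at h
      simpa using h
    · have h := coeff_radialContraction_eq_zero (p := 1) (q := 0) hX rfl
      rw [coeff_radialContraction] at h
      simpa using h
  · have h := card_le_of_binaryForm_eq_zero Nᶜ (fun i => (Γ.branch i).arc.tangent)
      (radialCoeff X μ) μ (exists_radialCoeff_ne_zero hX hν hν')
      (fun i _ j _ hij => Branch.tangent_det_ne_zero (hsmooth i) (hsmooth j) (htrans hij))
      (fun i _ => Branch.tangent_ne_zero (hsmooth i)) fun i hi =>
        sum_radialCoeff_eq_zero hsmooth htrans hν hX (hκ i (Finset.mem_compl.1 hi))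
    rw [Finset.card_compl, Fintype.card_fin] at h
    omega

theorem CurveGerm.IsSingular.two_le {Γ : CurveGerm} (h : Γ.IsSingular)
    (hsmooth : ∀ i, (Γ.branch i).IsSmooth) (i : Fin Γ.n) : 2 ≤ Γ.n := by
  by_contra hn
  have hn1 : Γ.n = 1 := by have := i.pos; omega
  have : Subsingleton (Fin Γ.n) := by rw [hn1]; infer_instance
  have h2 : ∏ j, (Γ.branch j).eqn = (Γ.branch i).eqn := by
    rw [Fintype.prod_subsingleton _ i]
  rw [CurveGerm.IsSingular, h2, hsmooth i] at h
  exact absurd h (by decide)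

end PlaneFoliation

theorem mainTheorem6 (F : PlaneFoliation.VectorField) (hF : F.SingularSetIsolated)
    (Γ : PlaneFoliation.CurveGerm) (hΓ : Γ.IsWeaklyIsolated F)
    (hsmooth : ∀ i, (Γ.branch i).IsSmooth)
    (htrans : Pairwise fun i j => (Γ.branch i).Transverse (Γ.branch j))
    (f : PlaneFoliation.O₂) (hf : Γ.IsReducedEquation f) (i : Fin Γ.n) :
    PlaneFoliation.vanishingOrder (PlaneFoliation.hamiltonian f) (Γ.branch i).arc ≤
        PlaneFoliation.vanishingOrder F (Γ.branch i).arc ∧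
      1 ≤ PlaneFoliation.vanishingOrder (PlaneFoliation.hamiltonian f) (Γ.branch i).arc := by
  obtain ⟨hsing, hinv, N, hN, -, -, hκ⟩ := hΓ
  have hn := hsing.two_le hsmooth i
  rw [PlaneFoliation.vanishingOrder_hamiltonian Γ hsmooth htrans hf i]
  refine ⟨?_, by exact_mod_cast (by omega : 1 ≤ Γ.n - 1)⟩
  obtain ⟨ν, hν, hν'⟩ := PlaneFoliation.exists_multiplicity hF
  have hcard : Γ.n ≤ ν + 1 := by
    by_cases hX : ((ν + 2 : ℕ) : ℕ∞) ≤ PlaneFoliation.mult (PlaneFoliation.radialContraction F)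
    · exact PlaneFoliation.card_le_of_dicritical hsmooth htrans hN hκ hν hν' hX
    · exact PlaneFoliation.card_le_of_not_dicritical hsmooth htrans hinv hν hX
  obtain ⟨h, H⟩ := PlaneFoliation.Branch.exists_isPullbackField (hsmooth i)
    (PlaneFoliation.Branch.pullback_eq_zero_of_dvd (hinv i))
  rw [PlaneFoliation.Branch.vanishingOrder_eq (hsmooth i) H]
  refine PowerSeries.nat_le_order h _ fun k hk => ?_
  exact PowerSeries.X_pow_dvd_iff.1
    (PlaneFoliation.Branch.X_pow_dvd_of_isPullbackField (hsmooth i) H hν) k (by omega)
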